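/- Let $\Omega\subset\mathbb R^2$ be a bounded open set and $\Delta=\partial_{11}+\partial_{22}$. For $k\in[1,\infty]$ and $\varepsilon\in(0,1]$ let $\mathcal D_{k,\varepsilon}$ be the set of functions $u\in W^{2,k}(\Omega)\cap C^{1,\varepsilon}(\bar\Omega)$ with $u=0$ on $\partial\Omega$, where $u\in C^{1,\varepsilon}(\bar\Omega)$ means that $u$ is continuous on $\bar\Omega$, differentiable in $\Omega$, and $\nabla u$ extends to an $\varepsilon$-Hölder continuous field on $\bar\Omega$. (1) (Gradient bound.) For all $1\le q<2$ and $C\ge 0$ there is a constant $C_q=C_q(\Omega,q,C)$ such that every $u\in\bigcup_{k,\varepsilon}\mathcal D_{k,\varepsilon}$ with $\int_\Omega|\Delta u|\,dx\le C$ satisfies $\|\nabla u\|_{L^q(\Omega)}\le C_q$. In particular this holds uniformly in $i$ for any sequence $(u_i)$ of such functions. (2) (Duality.) For every $p\in(2,\infty]$ there is a constant $K=K(\Omega,p)$ such that for every vector field $f\in L^{p}(\Omega;\mathbb R^2)$ the equation $-\Delta z=\operatorname{div} f$ has a weak solution $z\in W^{1,2}_0(\Omega)$, i.e. $\int_\Omega\nabla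 z\cdot\nabla\varphi\,dx=-\int_\Omega f\cdot\nabla\varphi\,dx$ for all $\varphi\in C_c^\infty(\Omega)$, and every such solution satisfies $\|z\|_{L^\infty(\Omega)}\le K\|f\|_{L^{p}(\Omega)}$ and, for every $u\in\bigcup_{k,\varepsilon}\mathcal D_{k,\varepsilon}$, $$\int_\Omega f\cdot\nabla u\,dx=-\int_\Omega\nabla z\cdot\nabla u\,dx=\int_\Omega z\,\Delta u\,dx .$$ (3) (Brezis–Merle setting.) Fix $k,\varepsilon,b,C$ and let $u_i\in\mathcal D_{k,\varepsilon}$ solve $-\Delta u_i=V_ie^{u_i}$ in $\Omega$, with $V_i$ measurable, $0\le V_i\le b$ a.e. and $\int_\Omega e^{u_i}dx\le C$ for all $i$. (a) Let $1\le q<2$ and let $u\in L^1_{loc}(\Omega)$ have a weak gradient $\nabla u\in L^1_{loc}(\Omega)$. If $\|\nabla(u_i-u)\|_{L^q(S)}\to0$ for every compact $S\subset\Omega$, then $\|\nabla(u_i-u)\|_{L^q(\Omega)}\to0$. (b) There are a subsequence $(u_{s(i)})$ and a function $u$ such that, for all $1\le q<2$, $u\in W^{1,q}_0(\Omega)$,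 $\|u_{s(i)}-u\|_{L^q(\Omega)}\to0$ and $\|\nabla(u_{s(i)}-u)\|_{L^q(\Omega)}\to0$. -/

import Mathlib

open MeasureTheory Filter Topology Set TopologicalSpace
open scoped NNReal ENNReal Distributions Laplacian

/-- The Euclidean plane `ℝ²`. -/
abbrev Plane : Type := EuclideanSpace ℝ (Fin 2)

/-- Lebesgue measure on the open set `Ω`. -/
noncomputable abbrev volOn (Ω : Opens Plane) : Measure Plane :=
  volume.restrict (Ω : Set Plane)

/-- `G` is the gradient of `u` on `Ω` in the sense of distributions:
`∫_Ω u ∂_v φ = - ∫_Ω (G · v) φ` for all test functions `φ` and all directions `v`. -/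
def HasWeakGradient (Ω : Opens Plane) (u : Plane → ℝ) (G : Plane → Plane) : Prop :=
  LocallyIntegrableOn u (Ω : Set Plane) volume ∧
  LocallyIntegrableOn G (Ω : Set Plane) volume ∧
  ∀ (φ : 𝓓(Ω, ℝ)) (v : Plane),
    ∫ x in (Ω : Set Plane), u x * inner ℝ (gradient φ x) v =
      - ∫ x in (Ω : Set Plane), inner ℝ (G x) v * φ x

/-- `L = Δu = ∂₁₁u + ∂₂₂u` on `Ω` in the sense of distributions. -/
def HasWeakLaplacian (Ω : Opens Plane) (u L : Plane → ℝ) : Prop :=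
  LocallyIntegrableOn u (Ω : Set Plane) volume ∧
  LocallyIntegrableOn L (Ω : Set Plane) volume ∧
  ∀ φ : 𝓓(Ω, ℝ),
    ∫ x in (Ω : Set Plane), u x * Δ (φ : Plane → ℝ) x =
      ∫ x in (Ω : Set Plane), L x * φ x

/-- `u ∈ W^{1,p}(Ω)` with weak gradient `G`. -/
def MemW1 (Ω : Opens Plane) (p : ℝ≥0∞) (u : Plane → ℝ) (G : Plane → Plane) : Prop :=
  MemLp u p (volOn Ω) ∧ MemLp G p (volOn Ω) ∧ HasWeakGradient Ω u G

/-- `u ∈ W_0^{1,p}(Ω)` with weak gradient `G`: the closure of the test functions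
in `W^{1,p}(Ω)`. -/
def MemW10 (Ω : Opens Plane) (p : ℝ≥0∞) (u : Plane → ℝ) (G : Plane → Plane) : Prop :=
  MemW1 Ω p u G ∧
  ∃ φ : ℕ → 𝓓(Ω, ℝ),
    Tendsto (fun n => eLpNorm (fun x => φ n x - u x) p (volOn Ω)) atTop (𝓝 0) ∧
    Tendsto (fun n => eLpNorm (fun x => gradient (φ n) x - G x) p (volOn Ω)) atTop (𝓝 0)

/-- `u ∈ W^{2,p}(Ω)`: `u ∈ W^{1,p}(Ω)` and each first weak derivative is in `W^{1,p}(Ω)`. -/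
def MemW2 (Ω : Opens Plane) (p : ℝ≥0∞) (u : Plane → ℝ) : Prop :=
  ∃ G : Plane → Plane, MemW1 Ω p u G ∧
    ∀ j : Fin 2, ∃ H : Plane → Plane, MemW1 Ω p (fun x => G x j) H

/-- `u ∈ C^{1,ε}(Ω̄)`: `u` is continuous on `Ω̄`, differentiable in `Ω`, and its gradient
extends to an `ε`-Hölder continuous vector field on `Ω̄`. -/
def MemC1Holder (Ω : Opens Plane) (ε : ℝ≥0) (u : Plane → ℝ) : Prop :=
  ContinuousOn u (closure (Ω : Set Plane)) ∧
  ∃ D : Plane → Plane, (∀ x ∈ Ω, HasGradientAt u (D x) x) ∧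
    ∃ M : ℝ≥0, HolderOnWith M ε D (closure (Ω : Set Plane))

/-- `u ∈ W^{2,k}(Ω) ∩ C^{1,ε}(Ω̄)` and `u = 0` on `∂Ω`. -/
def DirichletClass (Ω : Opens Plane) (k : ℝ≥0∞) (ε : ℝ≥0) (u : Plane → ℝ) : Prop :=
  MemW2 Ω k u ∧ MemC1Holder Ω ε u ∧ ∀ x ∈ frontier (Ω : Set Plane), u x = 0

/-- `z ∈ W_0^{1,2}(Ω)`, with weak gradient `Z`, is a weak solution of `-Δz = div f` in `Ω`. -/
def IsDivSolution (Ω : Opens Plane) (f : Plane → Plane) (z : Plane → ℝ) (Z : Plane → Plane) :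
    Prop :=
  MemW10 Ω 2 z Z ∧
  ∀ φ : 𝓓(Ω, ℝ),
    ∫ x in (Ω : Set Plane), inner ℝ (Z x) (gradient φ x) =
      - ∫ x in (Ω : Set Plane), inner ℝ (f x) (gradient φ x)

/-- The Dirichlet problem of Brezis and Merle: `-Δu = V e^u` in `Ω`, `u = 0` on `∂Ω`,
with `0 ≤ V ≤ b` and `∫_Ω e^u ≤ C`. -/
def IsBrezisMerleSolution (Ω : Opens Plane) (k : ℝ≥0∞) (ε : ℝ≥0) (b C : ℝ≥0)
    (V u : Plane → ℝ) : Prop :=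
  DirichletClass Ω k ε u ∧
  AEStronglyMeasurable V (volOn Ω) ∧
  (∀ᵐ x ∂(volOn Ω), 0 ≤ V x ∧ V x ≤ b) ∧
  HasWeakLaplacian Ω u (fun x => -(V x * Real.exp (u x))) ∧
  ∫⁻ x in (Ω : Set Plane), ENNReal.ofReal (Real.exp (u x)) ≤ C

variable {Ω : Opens Plane}

/-! Everything is done in energy form. A function of the Dirichlet class lies in `W_0^{1,2}`
(`memW10_of_continuousOn`, `DirichletClass.memW10`), and `-Δu = g` with `g ∈ L^1` may be tested with
bounded smooth functions of elements of `W_0^{1,2}` (`WeakDiv.integral_inner_comp`). No regularity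
of the boundary is needed.

Gradient bound (`exists_eLpNorm_gradient_le`). Testing with a bounded increasing function of `u`
whose derivative decays like `|u|^{-3/2}` bounds `∫ |∇u|² (1+u²)^{-3/4}` by a multiple of `‖g‖_1`.
Hence `v = u(1+u²)^{-3/8}`, which grows like `|u|^{1/4}`, has its gradient bounded in `L²`, and in
the plane Sobolev's inequality bounds `v` in every `L^m` with `m < ∞`. Since `∇u` is `∇v` times a
factor of polynomial growth in `v`, Hölder's inequality bounds `∇u` in `L^q` for each `q < 2`.

Duality (`exists_ae_abs_le_of_isDivSolution`). Lax-Milgram solves `-Δz = div f`. For `g ∈ L²` with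
`‖g‖_1 ≤ 1`, let `-Δu = g` in `W_0^{1,2}`; then `∫ g z = ∫ ∇u·∇z = -∫ f·∇u`, which the gradient
bound controls by `K ‖f‖_p`, because the exponent conjugate to `p > 2` is below 2. Taking normalised
indicators for `g` bounds `z` uniformly. Being bounded, `z` can then be tested against the
integrable `Δu` (`IsDivSolution.integral_inner_eq_integral_mul`).

Brezis-Merle sequences. The data `V_i e^{u_i}` are bounded by `bC` in `L^1`, so the gradients are
bounded in `L^r` for each `r < 2`. With `q < r < 2`, Hölder's inequality makes the `L^q` norm near
the boundary uniformly small, and local convergence becomes global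
(`tendsto_eLpNorm_of_forall_isCompact`). For compactness, Rellich's theorem (`exists_subseq_cauchy`)
and interpolation give a subsequence converging in `L²`. Testing the equation of a difference `w`
with `arctan (w/δ)` shows that smallness of `w` in `L²` makes `∇w` small in `L^1`
(`WeakDiv.sq_eLpNorm_one_le`). So the gradients are Cauchy in `L^1`, and interpolation with the
`L^r` bounds gives convergence in every `L^q`, `q < 2`. -/

theorem isFiniteMeasure_volOn (hΩ : Bornology.IsBounded (Ω : Set Plane)) :
    IsFiniteMeasure (volOn Ω) :=
  ⟨by simpa using hΩ.measure_lt_top⟩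

/-! ### Test functions: gradients, composition, integration by parts. -/

namespace TestFunction

theorem differentiable (φ : 𝓓(Ω, ℝ)) : Differentiable ℝ φ :=
  φ.contDiff.differentiable (by simp)

theorem norm_gradient {f : Plane → ℝ} (x : Plane) : ‖gradient f x‖ = ‖fderiv ℝ f x‖ := by
  rw [← toDual_gradient, LinearIsometryEquiv.norm_map]

theorem continuous_gradient (φ : 𝓓(Ω, ℝ)) : Continuous (gradient φ) :=
  (InnerProductSpace.toDual ℝ Plane).symm.continuous.comp
    (φ.contDiff.continuous_fderiv (by simp))

theorem hasCompactSupport_gradient (φ : 𝓓(Ω, ℝ)) : HasCompactSupport (gradient φ) :=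
  (φ.hasCompactSupport.fderiv (𝕜 := ℝ)).comp_left
    (g := (InnerProductSpace.toDual ℝ Plane).symm) (map_zero _)

theorem memLp (φ : 𝓓(Ω, ℝ)) (p : ℝ≥0∞) : MemLp φ p (volOn Ω) :=
  (φ.continuous.memLp_of_hasCompactSupport φ.hasCompactSupport).restrict _

theorem memLp_gradient (φ : 𝓓(Ω, ℝ)) (p : ℝ≥0∞) : MemLp (gradient φ) p (volOn Ω) :=
  (φ.continuous_gradient.memLp_of_hasCompactSupport φ.hasCompactSupport_gradient).restrict _

theorem exists_norm_le (φ : 𝓓(Ω, ℝ)) : ∃ M, ∀ x, ‖φ x‖ ≤ M :=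
  φ.hasCompactSupport.exists_bound_of_continuous φ.continuous

theorem exists_norm_gradient_le (φ : 𝓓(Ω, ℝ)) : ∃ M, ∀ x, ‖gradient φ x‖ ≤ M :=
  φ.hasCompactSupport_gradient.exists_bound_of_continuous φ.continuous_gradient

theorem apply_eq_zero (φ : 𝓓(Ω, ℝ)) {x : Plane} (hx : x ∉ Ω) : φ x = 0 :=
  image_eq_zero_of_notMem_tsupport fun h => hx (φ.tsupport_subset h)

theorem gradient_eq_zero (φ : 𝓓(Ω, ℝ)) {x : Plane} (hx : x ∉ Ω) : gradient φ x = 0 := by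
  have : fderiv ℝ φ x = 0 := image_eq_zero_of_notMem_tsupport fun h =>
    hx (φ.tsupport_subset (tsupport_fderiv_subset ℝ h))
  rw [gradient, this, map_zero]

theorem gradient_sub (φ ψ : 𝓓(Ω, ℝ)) (x : Plane) :
    gradient (φ - ψ : 𝓓(Ω, ℝ)) x = gradient φ x - gradient ψ x := by
  have : ((φ - ψ : 𝓓(Ω, ℝ)) : Plane → ℝ) = fun y => φ y - ψ y := by ext; simp
  rw [gradient, this, fderiv_fun_sub (φ.differentiable x) (ψ.differentiable x), map_sub]; rfl

theorem gradient_add (φ ψ : 𝓓(Ω, ℝ)) (x : Plane) :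
    gradient (φ + ψ : 𝓓(Ω, ℝ)) x = gradient φ x + gradient ψ x := by
  have : ((φ + ψ : 𝓓(Ω, ℝ)) : Plane → ℝ) = fun y => φ y + ψ y := by ext; simp
  rw [gradient, this, fderiv_fun_add (φ.differentiable x) (ψ.differentiable x), map_add]; rfl

theorem gradient_smul (c : ℝ) (φ : 𝓓(Ω, ℝ)) (x : Plane) :
    gradient (c • φ : 𝓓(Ω, ℝ)) x = c • gradient φ x := by
  have : ((c • φ : 𝓓(Ω, ℝ)) : Plane → ℝ) = fun y => c • φ y := by ext; simp
  rw [gradient, this, fderiv_fun_const_smul (φ.differentiable x), map_smul]; rfl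

/-- Composition of a test function with a smooth function vanishing at the origin. -/
noncomputable def comp (φ : 𝓓(Ω, ℝ)) (ψ : ℝ → ℝ) (hψ : ContDiff ℝ (⊤ : ℕ∞) ψ) (h0 : ψ 0 = 0) : 𝓓(Ω, ℝ) :=
  ⟨ψ ∘ φ, hψ.comp φ.contDiff, φ.hasCompactSupport.comp_left h0,
    (tsupport_comp_subset h0 φ).trans φ.tsupport_subset⟩

theorem comp_apply (φ : 𝓓(Ω, ℝ)) {ψ : ℝ → ℝ} (hψ : ContDiff ℝ (⊤ : ℕ∞) ψ) (h0 : ψ 0 = 0)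
    (x : Plane) : φ.comp ψ hψ h0 x = ψ (φ x) := rfl

theorem gradient_comp (φ : 𝓓(Ω, ℝ)) {ψ : ℝ → ℝ} (hψ : ContDiff ℝ (⊤ : ℕ∞) ψ) (h0 : ψ 0 = 0)
    (x : Plane) : gradient (φ.comp ψ hψ h0) x = deriv ψ (φ x) • gradient φ x := by
  have h := ((hψ.differentiable (by simp)) (φ x)).hasDerivAt.comp_hasFDerivAt x
    (φ.differentiable x).hasFDerivAt
  have : ((φ.comp ψ hψ h0 : 𝓓(Ω, ℝ)) : Plane → ℝ) = ψ ∘ φ := rfl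
  rw [gradient, this, h.fderiv, map_smul]; rfl

/-- A function continuous on `Ω` times a compactly supported continuous one is integrable. -/
theorem integrable_mul_of_tsupport_subset {h η : Plane → ℝ} (hh : ContinuousOn h Ω)
    (hη : Continuous η) (hc : HasCompactSupport η) (hs : tsupport η ⊆ Ω) :
    Integrable (fun x => h x * η x) volume := by
  refine Continuous.integrable_of_hasCompactSupport ?_ hc.mul_left
  refine continuous_of_tsupport fun x hx => ?_
  have hx' : x ∈ (Ω : Set Plane) := hs (closure_mono (Function.support_mul_subset_right _ _) hx)
  exact (hh.continuousAt (Ω.isOpen.mem_nhds hx')).mul hη.continuousAt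

/-- Integration by parts against a test function. -/
theorem integral_mul_inner_gradient (φ : 𝓓(Ω, ℝ)) {f : Plane → ℝ} {D : Plane → Plane}
    (hf : ∀ x ∈ Ω, HasGradientAt f (D x) x) (hD : ContinuousOn D Ω) (v : Plane) :
    ∫ x in (Ω : Set Plane), f x * inner ℝ (gradient φ x) v =
      - ∫ x in (Ω : Set Plane), inner ℝ (D x) v * φ x := by
  have hfc : ContinuousOn f Ω := HasGradientAt.continuousOn hf
  have hD' : ContinuousOn (fun x => fderiv ℝ f x v) Ω :=
    (hD.inner continuousOn_const).congr fun x hx => (hf x hx).fderiv_apply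
  have hs : tsupport (fun x => fderiv ℝ φ x v) ⊆ Ω :=
    ((tsupport_comp_subset (g := fun L : Plane →L[ℝ] ℝ => L v) (by simp) _).trans
      (tsupport_fderiv_subset ℝ)).trans φ.tsupport_subset
  have h := integral_mul_fderiv_eq_neg_fderiv_mul_of_integrable (μ := volume) (f := f) (g := φ)
    (v := v) (integrable_mul_of_tsupport_subset hD' φ.continuous φ.hasCompactSupport
      φ.tsupport_subset) (integrable_mul_of_tsupport_subset hfc
        ((φ.contDiff.continuous_fderiv (by simp)).clm_apply continuous_const)
        ((φ.hasCompactSupport.fderiv (𝕜 := ℝ)).comp_left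
          (g := fun L : Plane →L[ℝ] ℝ => L v) (by simp)) hs)
      (integrable_mul_of_tsupport_subset hfc φ.continuous φ.hasCompactSupport
        φ.tsupport_subset)
      (fun x hx => (hf x (φ.tsupport_subset hx)).differentiableAt)
      (fun x _ => φ.differentiable x)
  rw [setIntegral_eq_integral_of_forall_compl_eq_zero, setIntegral_eq_integral_of_forall_compl_eq_zero]
  · simp only [inner_gradient_left]
    rw [h]
    congr 1
    refine integral_congr_ae (.of_forall fun x => ?_)
    by_cases hx : x ∈ Ω
    · simp [(hf x hx).fderiv_apply]
    · simp [φ.apply_eq_zero hx]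
  · intro x hx; simp [φ.apply_eq_zero hx]
  · intro x hx; simp [φ.gradient_eq_zero hx]

end TestFunction

/-! ### Limits of test functions and the space `W_0^{1,p}`. -/

theorem MeasureTheory.LocallyIntegrableOn.of_memLp {E : Type*} [NormedAddCommGroup E] {f : Plane → E} {p : ℝ≥0∞}
    (hp : 1 ≤ p) (hf : MemLp f p (volOn Ω)) : LocallyIntegrableOn f Ω volume := by
  refine (locallyIntegrableOn_iff Ω.isOpen.isLocallyClosed).2 fun K hK hc => ?_
  have : MemLp f p (volume.restrict K) := hf.mono_measure (Measure.restrict_mono hK le_rfl)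
  have : IsFiniteMeasure (volume.restrict K) := ⟨by simpa using hc.measure_lt_top⟩
  exact MemLp.integrable hp ‹MemLp f p _›

/-- Convergence in `L^p` implies convergence of integrals against a bounded function. -/
theorem tendsto_integral_mul_of_tendsto_eLpNorm {μ : Measure Plane} [IsFiniteMeasure μ] {p : ℝ≥0∞}
    (hp : 1 ≤ p) {f : ℕ → Plane → ℝ} {g η : Plane → ℝ} (hf : ∀ n, MemLp (f n) p μ)
    (hg : MemLp g p μ) (h : Tendsto (fun n => eLpNorm (fun x => f n x - g x) p μ) atTop (𝓝 0))
    (hη : AEStronglyMeasurable η μ) {M : ℝ} (hM : ∀ x, ‖η x‖ ≤ M) :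
    Tendsto (fun n => ∫ x, f n x * η x ∂μ) atTop (𝓝 (∫ x, g x * η x ∂μ)) := by
  have hη' : MemLp η ∞ μ := memLp_top_of_bound hη M (.of_forall hM)
  refine tendsto_integral_of_L1' _ ?_ ?_ ?_
  · exact ((hg.integrable hp).mul_bdd hη (.of_forall hM)).aestronglyMeasurable
  · exact .of_forall fun n => ((hf n).integrable hp).mul_bdd hη (.of_forall hM)
  · have hM0 : ∀ n, eLpNorm ((fun x => f n x * η x) - fun x => g x * η x) 1 μ ≤
        ENNReal.ofReal M * (eLpNorm (fun x => f n x - g x) p μ * μ univ ^ (1 - 1 / p.toReal)) := by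
      intro n
      calc _ ≤ ENNReal.ofReal M * eLpNorm (fun x => f n x - g x) 1 μ := by
            refine eLpNorm_le_mul_eLpNorm_of_ae_le_mul (.of_forall fun x => ?_) 1
            simp only [Pi.sub_apply, ← sub_mul, norm_mul]
            rw [mul_comm]; gcongr; exact hM x
        _ ≤ _ := by
            gcongr
            have := eLpNorm_le_eLpNorm_mul_rpow_measure_univ hp
              ((hf n).sub hg).aestronglyMeasurable
            rw [ENNReal.toReal_one, div_one] at this
            exact this
    refine tendsto_of_tendsto_of_tendsto_of_le_of_le tendsto_const_nhds ?_ (fun _ => zero_le) hM0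
    have hfin : μ univ ^ (1 - 1 / p.toReal) ≠ ∞ := by
      refine ENNReal.rpow_ne_top_of_nonneg ?_ (measure_ne_top _ _)
      rcases eq_or_ne p ∞ with rfl | hp'
      · simp
      · have : 1 ≤ p.toReal := by simpa using ENNReal.toReal_mono hp' hp
        rw [sub_nonneg, div_le_one (by linarith)]; exact this
    have := ENNReal.Tendsto.const_mul (a := ENNReal.ofReal M)
      (ENNReal.Tendsto.mul_const (b := μ univ ^ (1 - 1 / p.toReal)) h (.inr hfin))
      (.inr ENNReal.ofReal_ne_top)
    simpa using this

/-- A pair approximated by test functions in `W^{1,p}` belongs to `W_0^{1,p}`. -/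
theorem MemW10.of_tendsto [IsFiniteMeasure (volOn Ω)] {p : ℝ≥0∞} (hp : 1 ≤ p) {u : Plane → ℝ}
    {U : Plane → Plane} (hu : MemLp u p (volOn Ω)) (hU : MemLp U p (volOn Ω)) (φ : ℕ → 𝓓(Ω, ℝ))
    (h1 : Tendsto (fun n => eLpNorm (fun x => φ n x - u x) p (volOn Ω)) atTop (𝓝 0))
    (h2 : Tendsto (fun n => eLpNorm (fun x => gradient (φ n) x - U x) p (volOn Ω)) atTop (𝓝 0)) :
    MemW10 Ω p u U := by
  refine ⟨⟨hu, hU, .of_memLp hp hu, .of_memLp hp hU, fun η v => ?_⟩, φ, h1, h2⟩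
  obtain ⟨M, hM⟩ := η.exists_norm_le
  obtain ⟨M', hM'⟩ := η.exists_norm_gradient_le
  have hin : ∀ {F : Plane → Plane}, MemLp F p (volOn Ω) →
      MemLp (fun x => inner ℝ (F x) v) p (volOn Ω) := fun hF => hF.inner_const v
  have e1 := tendsto_integral_mul_of_tendsto_eLpNorm hp (fun n => (φ n).memLp p) hu h1
    (η := fun x => inner ℝ (gradient η x) v)
    (η.continuous_gradient.inner continuous_const).aestronglyMeasurable (M := M' * ‖v‖)
    (fun x => (norm_inner_le_norm _ _).trans (by gcongr; exact hM' x))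
  have e2 := tendsto_integral_mul_of_tendsto_eLpNorm hp (fun n => hin ((φ n).memLp_gradient p))
    (hin hU) (η := η) (M := M) ?_ η.continuous.aestronglyMeasurable hM
  · refine tendsto_nhds_unique e1 (e2.neg.congr fun n => ?_)
    exact ((η.integral_mul_inner_gradient (fun x _ => ((φ n).differentiable x).hasGradientAt)
      (φ n).continuous_gradient.continuousOn v).symm)
  · have := ENNReal.Tendsto.const_mul (a := ENNReal.ofReal ‖v‖) h2 (.inr ENNReal.ofReal_ne_top)
    rw [mul_zero] at this
    refine tendsto_of_tendsto_of_tendsto_of_le_of_le tendsto_const_nhds this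
      (fun _ => zero_le) fun n => ?_
    refine eLpNorm_le_mul_eLpNorm_of_ae_le_mul (.of_forall fun x => ?_) p
    rw [← inner_sub_left, mul_comm]
    exact norm_inner_le_norm _ _

theorem MemW10.sub [IsFiniteMeasure (volOn Ω)] {p : ℝ≥0∞} (hp : 1 ≤ p) {u w : Plane → ℝ}
    {U W : Plane → Plane} (hu : MemW10 Ω p u U) (hw : MemW10 Ω p w W) :
    MemW10 Ω p (fun x => u x - w x) (fun x => U x - W x) := by
  obtain ⟨⟨hu1, hu2, -⟩, φ, hφ1, hφ2⟩ := hu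
  obtain ⟨⟨hw1, hw2, -⟩, η, hη1, hη2⟩ := hw
  refine .of_tendsto hp (hu1.sub hw1) (hu2.sub hw2) (fun n => φ n - η n) ?_ ?_
  · have := hφ1.add hη1
    rw [add_zero] at this
    refine tendsto_of_tendsto_of_tendsto_of_le_of_le tendsto_const_nhds this
      (fun _ => zero_le) fun n => ?_
    refine (eLpNorm_congr_ae (.of_forall fun x => ?_)).trans_le
      (eLpNorm_sub_le (((φ n).memLp p).sub hu1).1 (((η n).memLp p).sub hw1).1 hp)
    simp only [FunLike.coe_sub, Pi.sub_apply]; ring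
  · have := hφ2.add hη2
    rw [add_zero] at this
    refine tendsto_of_tendsto_of_tendsto_of_le_of_le tendsto_const_nhds this
      (fun _ => zero_le) fun n => ?_
    refine (eLpNorm_congr_ae (.of_forall fun x => ?_)).trans_le
      (eLpNorm_sub_le (((φ n).memLp_gradient p).sub hu2).1
        (((η n).memLp_gradient p).sub hw2).1 hp)
    simp only [TestFunction.gradient_sub, Pi.sub_apply]; abel

/-! ### Dominated convergence and the Hölder pairing. -/

section Holder
variable {α E : Type*} [MeasurableSpace α] {μ : Measure α} [NormedAddCommGroup E]

theorem tendsto_zero_of_le {a b : ℕ → ℝ≥0∞} (hb : Tendsto b atTop (𝓝 0)) (h : ∀ n, a n ≤ b n) :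
    Tendsto a atTop (𝓝 0) :=
  tendsto_of_tendsto_of_tendsto_of_le_of_le tendsto_const_nhds hb (fun _ => zero_le) h

theorem tendsto_const_mul_zero {c : ℝ≥0∞} (hc : c ≠ ∞) {a : ℕ → ℝ≥0∞}
    (ha : Tendsto a atTop (𝓝 0)) : Tendsto (fun n => c * a n) atTop (𝓝 0) := by
  simpa using ENNReal.Tendsto.const_mul ha (.inr hc)

/-- Dominated convergence in `L^p`, `p < ∞`. -/
theorem tendsto_eLpNorm_of_dominated {p : ℝ≥0∞} (hp0 : p ≠ 0) (hp : p ≠ ∞) {F : ℕ → α → E}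
    {b : α → ℝ} (hF : ∀ n, AEStronglyMeasurable (F n) μ) (hb : MemLp b p μ)
    (hle : ∀ n, ∀ᵐ x ∂μ, ‖F n x‖ ≤ b x)
    (hlim : ∀ᵐ x ∂μ, Tendsto (fun n => F n x) atTop (𝓝 0)) :
    Tendsto (fun n => eLpNorm (F n) p μ) atTop (𝓝 0) := by
  have hp' : 0 < p.toReal := ENNReal.toReal_pos hp0 hp
  simp only [eLpNorm_eq_lintegral_rpow_enorm_toReal hp0 hp]
  have h := tendsto_lintegral_of_dominated_convergence' (μ := μ)
    (F := fun n x => ‖F n x‖ₑ ^ p.toReal) (f := fun _ => 0) (fun x => ‖b x‖ₑ ^ p.toReal)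
    (fun n => ((hF n).enorm.pow_const _)) (fun n => ?_)
    (lintegral_rpow_enorm_lt_top_of_eLpNorm_lt_top hp0 hp hb.2).ne ?_
  · rw [lintegral_zero] at h
    have := (ENNReal.continuous_rpow_const (y := 1 / p.toReal)).continuousAt.tendsto.comp h
    simpa [Function.comp_def, hp'] using this
  · filter_upwards [hle n] with x hx
    gcongr
    exact enorm_le_iff_norm_le.2 (hx.trans (le_abs_self _))
  · filter_upwards [hlim] with x hx
    have := ((ENNReal.continuous_rpow_const (y := p.toReal)).comp continuous_enorm).continuousAt.tendsto.comp hx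
    simpa [Function.comp_def, hp'] using this

variable [InnerProductSpace ℝ E] {p q : ℝ≥0∞} [p.HolderConjugate q] {F V : α → E}

theorem eLpNorm_inner_le (hF : AEStronglyMeasurable F μ) (hV : AEStronglyMeasurable V μ) :
    eLpNorm (fun x => inner ℝ (F x) (V x)) 1 μ ≤ eLpNorm F p μ * eLpNorm V q μ := by
  have := eLpNorm_le_eLpNorm_mul_eLpNorm_of_nnnorm (p := p) (q := q) (r := 1) hF hV
    (fun x y => inner ℝ x y) 1 (.of_forall fun x => by simpa using nnnorm_inner_le_nnnorm _ _)
  simpa using this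

theorem integrable_inner_of_memLp (hF : MemLp F p μ) (hV : MemLp V q μ) :
    Integrable (fun x => inner ℝ (F x) (V x)) μ :=
  memLp_one_iff_integrable.1 ⟨hF.1.inner hV.1,
    (eLpNorm_inner_le hF.1 hV.1).trans_lt (ENNReal.mul_lt_top hF.2 hV.2)⟩

theorem enorm_integral_inner_le (hF : AEStronglyMeasurable F μ) (hV : AEStronglyMeasurable V μ) :
    ‖∫ x, inner ℝ (F x) (V x) ∂μ‖ₑ ≤ eLpNorm F p μ * eLpNorm V q μ :=
  (enorm_integral_le_lintegral_enorm _).trans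
    (by rw [← eLpNorm_one_eq_lintegral_enorm]; exact eLpNorm_inner_le hF hV)

theorem tendsto_integral_inner {G : ℕ → α → E} (hF : MemLp F p μ) (hG : ∀ n, MemLp (G n) q μ)
    (hV : MemLp V q μ) (h : Tendsto (fun n => eLpNorm (fun x => G n x - V x) q μ) atTop (𝓝 0)) :
    Tendsto (fun n => ∫ x, inner ℝ (F x) (G n x) ∂μ) atTop (𝓝 (∫ x, inner ℝ (F x) (V x) ∂μ)) := by
  refine tendsto_integral_of_L1' _ (integrable_inner_of_memLp hF hV).aestronglyMeasurable
    (.of_forall fun n => integrable_inner_of_memLp hF (hG n)) ?_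
  refine tendsto_zero_of_le (tendsto_const_mul_zero hF.2.ne h) fun n => ?_
  refine (eLpNorm_congr_ae (.of_forall fun x => ?_)).trans_le
    (eLpNorm_inner_le hF.1 ((hG n).sub hV).1)
  simp [inner_sub_right]

end Holder

/-! ### The chain rule in `W_0^{1,2}`. -/

/-- Nonlinear functions of the approximants are handled by dominated convergence, which needs almost
everywhere convergence; a subsequence supplies it. -/
theorem MemW10.exists_seq {u : Plane → ℝ} {U : Plane → Plane} (hu : MemW10 Ω 2 u U) :
    ∃ φ : ℕ → 𝓓(Ω, ℝ), (∀ᵐ x ∂(volOn Ω), Tendsto (fun n => φ n x) atTop (𝓝 (u x))) ∧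
      Tendsto (fun n => eLpNorm (fun x => φ n x - u x) 2 (volOn Ω)) atTop (𝓝 0) ∧
      Tendsto (fun n => eLpNorm (fun x => gradient (φ n) x - U x) 2 (volOn Ω)) atTop (𝓝 0) := by
  obtain ⟨⟨hu1, hu2, -⟩, φ, h1, h2⟩ := hu
  obtain ⟨s, hs, hae⟩ := (tendstoInMeasure_of_tendsto_eLpNorm (by simp)
    (fun n => ((φ n).memLp 2).1) hu1.1 h1).exists_seq_tendsto_ae
  exact ⟨φ ∘ s, hae, h1.comp hs.tendsto_atTop, h2.comp hs.tendsto_atTop⟩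

theorem lipschitz_of_deriv_le {ψ : ℝ → ℝ} (hψ : ContDiff ℝ (⊤ : ℕ∞) ψ) {M : ℝ}
    (hM : ∀ t, |deriv ψ t| ≤ M) (s t : ℝ) : ‖ψ s - ψ t‖ ≤ M * ‖s - t‖ :=
  Convex.norm_image_sub_le_of_norm_deriv_le (fun x _ => hψ.differentiable (by simp) x)
    (fun x _ => hM x) convex_univ (mem_univ t) (mem_univ s)

/-- Convergence of the gradients in the chain rule. -/
theorem tendsto_eLpNorm_gradient_comp {u : Plane → ℝ} {U : Plane → Plane} {φ : ℕ → 𝓓(Ω, ℝ)}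
    (hu : AEStronglyMeasurable u (volOn Ω)) (hU : MemLp U 2 (volOn Ω))
    (hae : ∀ᵐ x ∂(volOn Ω), Tendsto (fun n => φ n x) atTop (𝓝 (u x)))
    (h2 : Tendsto (fun n => eLpNorm (fun x => gradient (φ n) x - U x) 2 (volOn Ω)) atTop (𝓝 0))
    {ψ : ℝ → ℝ} (hψ : ContDiff ℝ (⊤ : ℕ∞) ψ) (h0 : ψ 0 = 0) {M : ℝ}
    (hM : ∀ t, |deriv ψ t| ≤ M) :
    Tendsto (fun n => eLpNorm (fun x => gradient ((φ n).comp ψ hψ h0) x - deriv ψ (u x) • U x) 2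
      (volOn Ω)) atTop (𝓝 0) := by
  have hψ' : Continuous (deriv ψ) := hψ.continuous_deriv (by simp)
  have hm : AEStronglyMeasurable (fun x => deriv ψ (u x)) (volOn Ω) :=
    hψ'.comp_aestronglyMeasurable hu
  have hmn : ∀ n, AEStronglyMeasurable (fun x => deriv ψ (φ n x)) (volOn Ω) := fun n =>
    (hψ'.comp (φ n).continuous).aestronglyMeasurable
  -- The error splits as `ψ'(φ_n)(∇φ_n - U) + (ψ'(φ_n) - ψ'(u)) U`. The second term is dominated by
  -- `2M|U|`; the first is at most `M|∇φ_n - U|`.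
  have key := tendsto_eLpNorm_of_dominated (μ := volOn Ω) (p := 2) (by simp) (by simp)
    (F := fun n x => (deriv ψ (φ n x) - deriv ψ (u x)) • U x) (b := fun x => 2 * M * ‖U x‖)
    (fun n => ((hmn n).sub hm).smul hU.1) (hU.norm.const_mul _) (fun n => .of_forall fun x => ?_) ?_
  · have hsum := (tendsto_const_mul_zero (c := ENNReal.ofReal M) ENNReal.ofReal_ne_top h2).add key
    rw [add_zero] at hsum
    refine tendsto_zero_of_le hsum fun n => ?_
    calc _ ≤ eLpNorm (fun x => deriv ψ (φ n x) • (gradient (φ n) x - U x)) 2 (volOn Ω) +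
          eLpNorm (fun x => (deriv ψ (φ n x) - deriv ψ (u x)) • U x) 2 (volOn Ω) := by
          refine (eLpNorm_congr_ae (.of_forall fun x => ?_)).trans_le
            (eLpNorm_add_le ((hmn n).smul (((φ n).memLp_gradient 2).sub hU).1)
              (((hmn n).sub hm).smul hU.1) (by simp))
          simp only [TestFunction.gradient_comp, Pi.add_apply]
          module
      _ ≤ _ := by
          gcongr
          refine eLpNorm_le_mul_eLpNorm_of_ae_le_mul (.of_forall fun x => ?_) 2
          rw [norm_smul]
          gcongr
          exact hM _
  · rw [norm_smul]
    gcongr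
    calc _ ≤ |deriv ψ (φ n x)| + |deriv ψ (u x)| := norm_sub_le _ _
      _ ≤ 2 * M := by linarith [hM (φ n x), hM (u x)]
  · filter_upwards [hae] with x hx
    have : Tendsto (fun n => deriv ψ (φ n x) - deriv ψ (u x)) atTop (𝓝 0) := by
      simpa using ((hψ'.tendsto _).comp hx).sub_const (deriv ψ (u x))
    simpa using this.smul_const (U x)

theorem memLp_deriv_comp_smul {u : Plane → ℝ} {U : Plane → Plane}
    (hu : AEStronglyMeasurable u (volOn Ω)) {p : ℝ≥0∞} (hU : MemLp U p (volOn Ω))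
    {ψ : ℝ → ℝ} (hψ : ContDiff ℝ (⊤ : ℕ∞) ψ) {M : ℝ} (hM : ∀ t, |deriv ψ t| ≤ M) :
    MemLp (fun x => deriv ψ (u x) • U x) p (volOn Ω) :=
  hU.of_le_mul (c := M)
    (((hψ.continuous_deriv (by simp)).comp_aestronglyMeasurable hu).smul hU.1)
    (.of_forall fun x => by rw [norm_smul]; gcongr; exact hM _)

/-- Chain rule in `W_0^{1,2}`. -/
theorem MemW10.comp [IsFiniteMeasure (volOn Ω)] {u : Plane → ℝ} {U : Plane → Plane}
    (hu : MemW10 Ω 2 u U) {ψ : ℝ → ℝ} (hψ : ContDiff ℝ (⊤ : ℕ∞) ψ) (h0 : ψ 0 = 0) {M : ℝ}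
    (hM : ∀ t, |deriv ψ t| ≤ M) :
    MemW10 Ω 2 (fun x => ψ (u x)) (fun x => deriv ψ (u x) • U x) := by
  obtain ⟨φ, hae, h1, h2⟩ := hu.exists_seq
  have hum := hu.1.1
  refine .of_tendsto (by simp) ?_ (memLp_deriv_comp_smul hum.1 hu.1.2.1 hψ hM)
    (fun n => (φ n).comp ψ hψ h0) ?_ (tendsto_eLpNorm_gradient_comp hum.1 hu.1.2.1 hae h2 hψ h0 hM)
  · refine hum.of_le_mul (c := M) (hψ.continuous.comp_aestronglyMeasurable hum.1)
      (.of_forall fun x => ?_)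
    simpa [h0] using lipschitz_of_deriv_le hψ hM (u x) 0
  · refine tendsto_zero_of_le (tendsto_const_mul_zero (c := ENNReal.ofReal M)
      ENNReal.ofReal_ne_top h1) fun n => ?_
    exact eLpNorm_le_mul_eLpNorm_of_ae_le_mul
      (.of_forall fun x => lipschitz_of_deriv_le hψ hM _ _) 2

/-! ### Equations in divergence form and their admissible test functions. -/

/-- `-div F = g` in the sense of distributions. -/
def WeakDiv (Ω : Opens Plane) (F : Plane → Plane) (g : Plane → ℝ) : Prop :=
  ∀ φ : 𝓓(Ω, ℝ), ∫ x in (Ω : Set Plane), inner ℝ (F x) (gradient φ x) =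
    ∫ x in (Ω : Set Plane), g x * φ x

theorem WeakDiv.sub {F F' : Plane → Plane} {g g' : Plane → ℝ} (h : WeakDiv Ω F g)
    (h' : WeakDiv Ω F' g') (hF : MemLp F 2 (volOn Ω)) (hF' : MemLp F' 2 (volOn Ω))
    (hg : Integrable g (volOn Ω)) (hg' : Integrable g' (volOn Ω)) :
    WeakDiv Ω (fun x => F x - F' x) (fun x => g x - g' x) := by
  intro φ
  obtain ⟨M, hM⟩ := φ.exists_norm_le
  have hφ := φ.continuous.aestronglyMeasurable (μ := volOn Ω)
  simp only [inner_sub_left, sub_mul]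
  rw [integral_sub (integrable_inner_of_memLp hF (φ.memLp_gradient 2))
    (integrable_inner_of_memLp hF' (φ.memLp_gradient 2)),
    integral_sub (hg.mul_bdd hφ (.of_forall hM)) (hg'.mul_bdd hφ (.of_forall hM)), h φ, h' φ]

/-- Both sides are continuous in the `W^{1,2}` norm because `F` and `g` are in `L²`, so the identity
passes from test functions to their closure. -/
theorem WeakDiv.integral_inner {F : Plane → Plane} {g : Plane → ℝ} (h : WeakDiv Ω F g)
    (hF : MemLp F 2 (volOn Ω)) (hg : MemLp g 2 (volOn Ω)) {u : Plane → ℝ} {U : Plane → Plane}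
    (hu : MemW10 Ω 2 u U) :
    ∫ x in (Ω : Set Plane), inner ℝ (F x) (U x) = ∫ x in (Ω : Set Plane), g x * u x := by
  obtain ⟨⟨hu1, hu2, -⟩, φ, h1, h2⟩ := hu
  have e1 := tendsto_integral_inner hF (fun n => (φ n).memLp_gradient 2) hu2 h2
  have e2 := tendsto_integral_inner hg (fun n => (φ n).memLp 2) hu1 h1
  refine tendsto_nhds_unique e1 ?_
  simp only [h _]
  simpa [mul_comm] using e2

/-- Bounded smooth functions of `u ∈ W_0^{1,2}` are admissible when the datum is only `L^1`. -/
theorem WeakDiv.integral_inner_comp {F : Plane → Plane} {g : Plane → ℝ} (h : WeakDiv Ω F g)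
    (hF : MemLp F 2 (volOn Ω)) (hg : Integrable g (volOn Ω)) {u : Plane → ℝ} {U : Plane → Plane}
    (hu : MemW10 Ω 2 u U) {ψ : ℝ → ℝ} (hψ : ContDiff ℝ (⊤ : ℕ∞) ψ) (h0 : ψ 0 = 0) {M B : ℝ}
    (hM : ∀ t, |deriv ψ t| ≤ M) (hB : ∀ t, |ψ t| ≤ B) :
    ∫ x in (Ω : Set Plane), inner ℝ (F x) (deriv ψ (u x) • U x) =
      ∫ x in (Ω : Set Plane), g x * ψ (u x) := by
  obtain ⟨φ, hae, h1, h2⟩ := hu.exists_seq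
  have e1 := tendsto_integral_inner hF (fun n => ((φ n).comp ψ hψ h0).memLp_gradient 2)
    (memLp_deriv_comp_smul hu.1.1.1 hu.1.2.1 hψ hM)
    (tendsto_eLpNorm_gradient_comp hu.1.1.1 hu.1.2.1 hae h2 hψ h0 hM)
  refine tendsto_nhds_unique e1 ?_
  simp only [h _, TestFunction.comp_apply]
  -- With `g` merely integrable, the bound `B` on `ψ` provides the dominating function `B|g|`.
  refine tendsto_integral_of_dominated_convergence (fun x => ‖g x‖ * B)
    (fun n => hg.1.mul (hψ.continuous.comp (φ n).continuous).aestronglyMeasurable)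
    (hg.norm.mul_const _) (fun n => .of_forall fun x => ?_) ?_
  · rw [norm_mul]; gcongr; exact hB _
  · filter_upwards [hae] with x hx
    exact ((hψ.continuous.tendsto _).comp hx).const_mul _

/-! ### Sobolev inequalities in the plane. -/

/-- Sobolev inequality for test functions, subcritical exponent. -/
theorem TestFunction.sobolev (hΩ : Bornology.IsBounded (Ω : Set Plane)) {p q : ℝ≥0} (hp : 1 ≤ p)
    (hp2 : p < 2) (hpq : (p : ℝ)⁻¹ - 2⁻¹ ≤ (q : ℝ)⁻¹) :
    ∃ C : ℝ≥0, ∀ φ : 𝓓(Ω, ℝ),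
      eLpNorm φ q (volOn Ω) ≤ C * eLpNorm (gradient φ) p (volOn Ω) := by
  refine ⟨eLpNormLESNormFDerivOfLeConst ℝ (volume : Measure Plane) Ω p q, fun φ => ?_⟩
  have hs : Function.support φ ⊆ Ω := (subset_tsupport _).trans φ.tsupport_subset
  have h := eLpNorm_le_eLpNorm_fderiv_of_le (volume : Measure Plane) (u := φ) (s := Ω)
    (φ.contDiff.of_le (by exact_mod_cast le_top)) hs hp (q := q) (by simpa using hp2)
    (by simpa using hpq) hΩ
  refine (eLpNorm_mono_measure _ Measure.restrict_le_self).trans (h.trans_eq ?_)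
  congr 1
  rw [volOn, eLpNorm_restrict_eq_of_support_subset]
  · exact eLpNorm_congr_norm_ae (.of_forall fun x => (TestFunction.norm_gradient x).symm)
  · intro x hx
    by_contra h
    exact hx (φ.gradient_eq_zero h)

/-- The exponent 2 is critical in the plane, so the gradient is first weakened to `L^p` with `p =
2m/(m+2) < 2`, whose Sobolev conjugate is exactly `m`; finiteness of the measure pays for the
passage from `L²` to `L^p`. -/
theorem TestFunction.sobolev_two (hΩ : Bornology.IsBounded (Ω : Set Plane)) {m : ℝ≥0}
    (hm : 2 ≤ m) :
    ∃ C : ℝ≥0, ∀ φ : 𝓓(Ω, ℝ),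
      eLpNorm φ m (volOn Ω) ≤ C * eLpNorm (gradient φ) 2 (volOn Ω) := by
  have := isFiniteMeasure_volOn hΩ
  have hm' : (2 : ℝ) ≤ m := by exact_mod_cast hm
  set p : ℝ≥0 := 2 * m / (m + 2) with hp
  have hpr : (p : ℝ) = 2 * m / (m + 2) := by simp [hp]
  have hp1 : 1 ≤ p := by
    rw [← NNReal.coe_le_coe, hpr, NNReal.coe_one, le_div_iff₀ (by positivity)]; linarith
  have hp2 : p < 2 := by
    rw [← NNReal.coe_lt_coe, hpr, NNReal.coe_ofNat, div_lt_iff₀ (by positivity)]; linarith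
  obtain ⟨C, hC⟩ := TestFunction.sobolev hΩ hp1 hp2 (q := m) (by
    rw [hpr]; have : (m : ℝ) ≠ 0 := by positivity
    field_simp; linarith)
  have hfin : volOn Ω univ ^ (1 / (p : ℝ≥0∞).toReal - 1 / (2 : ℝ≥0∞).toReal) ≠ ∞ := by
    refine ENNReal.rpow_ne_top_of_nonneg ?_ (measure_ne_top _ _)
    rw [sub_nonneg]
    have h2 : (p : ℝ) ≤ 2 := by exact_mod_cast hp2.le
    have h1 : (1 : ℝ) ≤ p := by exact_mod_cast hp1
    simpa using inv_anti₀ (by linarith) h2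
  refine ⟨C * (volOn Ω univ ^ (1 / (p : ℝ≥0∞).toReal - 1 / (2 : ℝ≥0∞).toReal)).toNNReal,
    fun φ => (hC φ).trans ?_⟩
  rw [ENNReal.coe_mul, ENNReal.coe_toNNReal hfin, mul_assoc, mul_comm (_ ^ _)]
  gcongr
  exact eLpNorm_le_eLpNorm_mul_rpow_measure_univ (by exact_mod_cast hp2.le)
    (φ.memLp_gradient 2).1

/-- Inequalities between `L^p` norms of test functions and of their gradients pass to
`W_0^{1,p}`. -/
theorem MemW10.eLpNorm_le {p m : ℝ≥0∞} (hp : 1 ≤ p) {C : ℝ≥0}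
    (hC : ∀ φ : 𝓓(Ω, ℝ), eLpNorm φ m (volOn Ω) ≤ C * eLpNorm (gradient φ) p (volOn Ω))
    {u : Plane → ℝ} {U : Plane → Plane} (hu : MemW10 Ω p u U) :
    eLpNorm u m (volOn Ω) ≤ C * eLpNorm U p (volOn Ω) := by
  obtain ⟨⟨hu1, hu2, -⟩, φ, h1, h2⟩ := hu
  obtain ⟨s, hs, hae⟩ := (tendstoInMeasure_of_tendsto_eLpNorm (by positivity)
    (fun n => ((φ n).memLp p).1) hu1.1 h1).exists_seq_tendsto_ae
  have hlim : Tendsto (fun n => C * (eLpNorm (fun x => gradient (φ (s n)) x - U x) p (volOn Ω) +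
      eLpNorm U p (volOn Ω))) atTop (𝓝 (C * eLpNorm U p (volOn Ω))) := by
    have := ENNReal.Tendsto.const_mul (a := C)
      ((h2.comp hs.tendsto_atTop).add_const (eLpNorm U p (volOn Ω)))
      (.inr ENNReal.coe_ne_top)
    simpa using this
  -- Fatou's lemma: a priori `u` is not known to be in `L^m`, only to be an almost everywhere limit
  -- of functions bounded there.
  refine (Lp.eLpNorm_lim_le_liminf_eLpNorm (fun n => ((φ (s n)).memLp p).1) u hae).trans ?_
  rw [← hlim.liminf_eq]
  refine liminf_le_liminf (.of_forall fun n => (hC _).trans ?_)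
  gcongr
  refine (eLpNorm_congr_ae (.of_forall fun x => ?_)).trans_le
    (eLpNorm_add_le (((φ (s n)).memLp_gradient p).sub hu2).1 hu2.1 hp)
  simp

/-! ### The energy estimate. -/

theorem sq_eLpNorm_two {α E : Type*} [MeasurableSpace α] {μ : Measure α} [NormedAddCommGroup E]
    (f : α → E) : eLpNorm f 2 μ ^ 2 = ∫⁻ x, ‖f x‖ₑ ^ 2 ∂μ := by
  have := eLpNorm_nnreal_pow_eq_lintegral (μ := μ) (f := f) (p := 2) (by simp)
  simpa using this

/-- Energy estimate with a bounded nonlinearity and an `L^1` datum. -/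
theorem WeakDiv.sq_eLpNorm_le {g : Plane → ℝ} {u : Plane → ℝ} {U : Plane → Plane}
    (h : WeakDiv Ω U g) (hg : Integrable g (volOn Ω)) (hu : MemW10 Ω 2 u U)
    {ψ : ℝ → ℝ} (hψ : ContDiff ℝ (⊤ : ℕ∞) ψ) (h0 : ψ 0 = 0) {M B : ℝ}
    (hM : ∀ t, |deriv ψ t| ≤ M) (hB : ∀ t, |ψ t| ≤ B) {χ : ℝ → ℝ} {c : ℝ} (hc : 0 ≤ c)
    (hχ : ∀ t, χ t ^ 2 ≤ c * deriv ψ t) :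
    eLpNorm (fun x => χ (u x) • U x) 2 (volOn Ω) ^ 2 ≤
      ENNReal.ofReal (c * B) * eLpNorm g 1 (volOn Ω) := by
  have hU := hu.1.2.1
  -- Tested with `ψ(u)`, the equation has left side `∫ ψ'(u)|U|²`, and `c` times this dominates `∫
  -- χ(u)²|U|²`; the right side is at most `B‖g‖_1`.
  have key := h.integral_inner_comp hU hg hu hψ h0 hM hB
  have hint := (integrable_inner_of_memLp hU
    (memLp_deriv_comp_smul hu.1.1.1 hU hψ hM)).const_mul c
  have hpt : ∀ x, χ (u x) ^ 2 * ‖U x‖ ^ 2 ≤ c * inner ℝ (U x) (deriv ψ (u x) • U x) := fun x => by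
    rw [real_inner_smul_right, real_inner_self_eq_norm_sq, ← mul_assoc]
    gcongr; exact hχ _
  have hB0 : 0 ≤ B := (abs_nonneg _).trans (hB 0)
  calc _ = ∫⁻ x in (Ω : Set Plane), ENNReal.ofReal (χ (u x) ^ 2 * ‖U x‖ ^ 2) := by
        rw [sq_eLpNorm_two]
        refine lintegral_congr fun x => ?_
        rw [← ofReal_norm, ← ENNReal.ofReal_pow (norm_nonneg _), norm_smul, mul_pow,
          Real.norm_eq_abs, sq_abs]
    _ ≤ ∫⁻ x in (Ω : Set Plane), ENNReal.ofReal (c * inner ℝ (U x) (deriv ψ (u x) • U x)) :=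
        lintegral_mono fun x => ENNReal.ofReal_le_ofReal (hpt x)
    _ = ENNReal.ofReal (c * ∫ x in (Ω : Set Plane), g x * ψ (u x)) := by
        rw [← ofReal_integral_eq_lintegral_ofReal hint
          (.of_forall fun x => (by positivity : (0 : ℝ) ≤ _).trans (hpt x)), integral_const_mul, key]
    _ ≤ ENNReal.ofReal (c * B * ∫ x in (Ω : Set Plane), ‖g x‖) := by
        rw [mul_assoc]
        refine ENNReal.ofReal_le_ofReal (mul_le_mul_of_nonneg_left ?_ hc)
        rw [← integral_const_mul]
        refine (Real.le_norm_self _).trans (norm_integral_le_of_norm_le (hg.norm.const_mul B)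
          (.of_forall fun x => ?_))
        rw [norm_mul, mul_comm]
        gcongr; exact hB _
    _ = _ := by
        rw [ENNReal.ofReal_mul (by positivity), eLpNorm_one_eq_lintegral_enorm,
          ofReal_integral_norm_eq_lintegral_enorm hg]

/-! ### Calculus of the nonlinear substitutions. -/

/-- The substitution `t (1 + t²)^{-a}`. -/
noncomputable def powerSubst (a t : ℝ) : ℝ := t * (1 + t ^ 2) ^ (-a)

theorem contDiff_powerSubst (a : ℝ) : ContDiff ℝ (⊤ : ℕ∞) (powerSubst a) := by
  unfold powerSubst
  exact contDiff_id.mul (ContDiff.rpow_const_of_ne (by fun_prop) fun t => by positivity)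

theorem powerSubst_zero (a : ℝ) : powerSubst a 0 = 0 := by simp [powerSubst]

theorem hasDerivAt_powerSubst (a t : ℝ) :
    HasDerivAt (powerSubst a)
      ((1 + t ^ 2) ^ (-a) * ((1 + (1 - 2 * a) * t ^ 2) / (1 + t ^ 2))) t := by
  have h1 : HasDerivAt (fun t : ℝ => 1 + t ^ 2) (2 * t) t := by
    simpa using (hasDerivAt_pow 2 t).const_add 1
  have h2 := (hasDerivAt_id t).mul (h1.rpow_const (p := -a) (.inl (by positivity)))
  convert! h2 using 1
  rw [Real.rpow_sub_one (by positivity)]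
  simp only [id]
  field_simp
  ring

theorem deriv_powerSubst (a t : ℝ) : deriv (powerSubst a) t =
    (1 + t ^ 2) ^ (-a) * ((1 + (1 - 2 * a) * t ^ 2) / (1 + t ^ 2)) :=
  (hasDerivAt_powerSubst a t).deriv

theorem one_add_sq_rpow_neg_le_one {a : ℝ} (ha : 0 ≤ a) (t : ℝ) : (1 + t ^ 2) ^ (-a) ≤ 1 :=
  Real.rpow_le_one_of_one_le_of_nonpos (by nlinarith [sq_nonneg t]) (by linarith)

theorem abs_deriv_powerSubst_le {a : ℝ} (ha : 0 ≤ a) (ha' : a ≤ 1 / 2) (t : ℝ) :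
    |deriv (powerSubst a) t| ≤ (1 + t ^ 2) ^ (-a) := by
  rw [deriv_powerSubst, abs_of_nonneg]
  · refine mul_le_of_le_one_right (by positivity) ?_
    rw [div_le_one (by positivity)]
    nlinarith [sq_nonneg t]
  · have : 0 ≤ (1 - 2 * a) * t ^ 2 := mul_nonneg (by linarith) (sq_nonneg t)
    positivity

theorem le_deriv_powerSubst {a : ℝ} (ha : 0 ≤ a) (t : ℝ) :
    (1 - 2 * a) * (1 + t ^ 2) ^ (-a) ≤ deriv (powerSubst a) t := by
  rw [deriv_powerSubst, mul_comm]
  gcongr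
  rw [le_div_iff₀ (by positivity)]
  nlinarith

theorem deriv_arctan_powerSubst (t : ℝ) :
    deriv (fun t => Real.arctan (powerSubst (1 / 4) t)) t =
      1 / (1 + powerSubst (1 / 4) t ^ 2) * deriv (powerSubst (1 / 4)) t := by
  rw [deriv_powerSubst]
  exact (hasDerivAt_powerSubst _ t).arctan.deriv

theorem abs_deriv_arctan_powerSubst_le (t : ℝ) :
    |deriv (fun t => Real.arctan (powerSubst (1 / 4) t)) t| ≤ 1 := by
  rw [deriv_arctan_powerSubst, abs_mul]
  have h1 := (abs_deriv_powerSubst_le (a := 1 / 4) (by norm_num) (by norm_num) t).trans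
    (one_add_sq_rpow_neg_le_one (by norm_num) t)
  have h2 : |1 / (1 + powerSubst (1 / 4) t ^ 2)| ≤ 1 := by
    rw [abs_of_pos (by positivity), div_le_one (by positivity)]
    nlinarith [sq_nonneg (powerSubst (1 / 4) t)]
  exact mul_le_one₀ h2 (abs_nonneg _) h1

/-- Powers of `1 + t²` expressed through `d = (1 + t²)^{-1/4}`. -/
theorem rpow_quarter_relations (t : ℝ) :
    ((1 + t ^ 2) ^ (-(1 / 4) : ℝ)) ^ 4 * (1 + t ^ 2) = 1 ∧
    ((1 + t ^ 2) ^ (-(3 / 8) : ℝ)) ^ 2 = ((1 + t ^ 2) ^ (-(1 / 4) : ℝ)) ^ 3 := by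
  have ha : 0 < 1 + t ^ 2 := by positivity
  generalize 1 + t ^ 2 = a at ha
  constructor
  · rw [← Real.rpow_natCast, ← Real.rpow_mul ha.le, ← Real.rpow_add_one ha.ne']; norm_num
  · rw [← Real.rpow_natCast, ← Real.rpow_mul ha.le, ← Real.rpow_natCast, ← Real.rpow_mul ha.le]
    norm_num

/-- This is the compatibility between the test function `arctan (u(1+u²)^{-1/4})` and the
substitution with exponent `3/8`: both sides decay like `|t|^{-3/2}`. With `d = (1+t²)^{-1/4}` the
left side is at most `d³`, and everything reduces to `d³(1 + t²d²) ≤ 2d`. -/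
theorem sq_deriv_powerSubst_le (t : ℝ) : deriv (powerSubst (3 / 8)) t ^ 2 ≤
    4 * deriv (fun t => Real.arctan (powerSubst (1 / 4) t)) t := by
  have ha : 0 < 1 + t ^ 2 := by positivity
  have h1 := abs_deriv_powerSubst_le (a := 3 / 8) (by norm_num) (by norm_num) t
  have h2 := le_deriv_powerSubst (a := 1 / 4) (by norm_num) t
  obtain ⟨r1, r2⟩ := rpow_quarter_relations t
  have hd0 : 0 < (1 + t ^ 2) ^ (-(1 / 4) : ℝ) := by positivity
  have hd1 : (1 + t ^ 2) ^ (-(1 / 4) : ℝ) ≤ 1 := one_add_sq_rpow_neg_le_one (by norm_num) t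
  rw [deriv_arctan_powerSubst]
  have hb : deriv (powerSubst (3 / 8)) t ^ 2 ≤ ((1 + t ^ 2) ^ (-(1 / 4) : ℝ)) ^ 3 := by
    rw [← r2, ← sq_abs]; gcongr
  refine hb.trans ?_
  have hs : powerSubst (1 / 4) t ^ 2 = t ^ 2 * ((1 + t ^ 2) ^ (-(1 / 4) : ℝ)) ^ 2 := by
    rw [powerSubst, mul_pow]
  rw [hs]
  generalize (1 + t ^ 2) ^ (-(1 / 4) : ℝ) = d at *
  rw [one_div_mul_eq_div, mul_div_assoc', le_div_iff₀ (by positivity)]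
  have hd2 : d ^ 2 ≤ 1 := pow_le_one₀ hd0.le hd1
  have hd3 : d ^ 3 ≤ d := by nlinarith
  -- The relation `d⁴(1+t²) = 1` eliminates `t`: the product becomes `d³ + d - d⁵`.
  have : d ^ 3 * (1 + t ^ 2 * d ^ 2) = d ^ 3 + d * (d ^ 4 * (1 + t ^ 2)) - d ^ 5 := by ring
  rw [this, r1]
  have : 0 ≤ d ^ 5 := by positivity
  linarith

/-- The factor recovering `∇u` from `∇v` grows like `|u|^{3/4}`, that is like `|v|³`; the quartic
bound is cruder but polynomial in `v`, which suffices since `v` lies in every `L^m` with `m < ∞`. -/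
theorem inv_deriv_powerSubst_le (t : ℝ) :
    0 < deriv (powerSubst (3 / 8)) t ∧
    (deriv (powerSubst (3 / 8)) t)⁻¹ ≤ 4 * (1 + powerSubst (3 / 8) t ^ 2) ^ 2 := by
  have h2 := le_deriv_powerSubst (a := 3 / 8) (by norm_num) t
  obtain ⟨r1, r2⟩ := rpow_quarter_relations t
  have hd0 : 0 < (1 + t ^ 2) ^ (-(1 / 4) : ℝ) := by positivity
  have hb0 : 0 < (1 + t ^ 2) ^ (-(3 / 8) : ℝ) := by positivity
  have hd1 : (1 + t ^ 2) ^ (-(1 / 4) : ℝ) ≤ 1 := one_add_sq_rpow_neg_le_one (by norm_num) t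
  have hv : powerSubst (3 / 8) t ^ 2 = t ^ 2 * ((1 + t ^ 2) ^ (-(3 / 8) : ℝ)) ^ 2 := by
    rw [powerSubst, mul_pow]
  have hpos : 0 < deriv (powerSubst (3 / 8)) t := lt_of_lt_of_le (by positivity) h2
  refine ⟨hpos, ?_⟩
  have hv' : 0 ≤ powerSubst (3 / 8) t ^ 2 := sq_nonneg _
  generalize powerSubst (3 / 8) t ^ 2 = w at *
  generalize (1 + t ^ 2) ^ (-(1 / 4) : ℝ) = d at *
  generalize (1 + t ^ 2) ^ (-(3 / 8) : ℝ) = b at *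
  generalize deriv (powerSubst (3 / 8)) t = D at *
  -- Here `w = t²d³`, so `d(1+w) = d + 1 - d⁴`, and `d ≤ 1`.
  have hw : 1 ≤ d * (1 + w) := by
    have : d * (1 + w) = d + d ^ 4 * (1 + t ^ 2) - d ^ 4 := by rw [hv, r2]; ring
    rw [this, r1]
    have : d ^ 4 ≤ d := pow_le_of_le_one hd0.le hd1 (by norm_num)
    linarith
  have hb : 1 ≤ b * (1 + w) ^ 2 := by
    have e1 : 1 ≤ (b * (1 + w) ^ 2) ^ 2 := by
      have : (b * (1 + w) ^ 2) ^ 2 = (d * (1 + w)) ^ 3 * (1 + w) := by rw [mul_pow, r2]; ring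
      rw [this]
      exact one_le_mul_of_one_le_of_one_le (one_le_pow₀ hw) (by linarith)
    have h0 : 0 ≤ b * (1 + w) ^ 2 := by positivity
    nlinarith
  rw [inv_le_iff_one_le_mul₀ hpos]
  nlinarith [sq_nonneg (1 + w)]

/-! ### The gradient estimate. -/

theorem exists_holderTriple_two {q : ℝ≥0∞} (hq1 : 1 ≤ q) (hq2 : q < 2) :
    ∃ r : ℝ≥0, 2 ≤ r ∧ (r : ℝ≥0∞).HolderTriple 2 q := by
  have hqi : (2 : ℝ≥0∞)⁻¹ < q⁻¹ := ENNReal.inv_lt_inv.2 hq2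
  have hr0 : q⁻¹ - 2⁻¹ ≠ 0 := (tsub_pos_of_lt hqi).ne'
  refine ⟨(q⁻¹ - 2⁻¹)⁻¹.toNNReal, ?_, ?_⟩
  · rw [← ENNReal.coe_le_coe, ENNReal.coe_toNNReal (ENNReal.inv_ne_top.2 hr0), ENNReal.coe_ofNat,
      ENNReal.le_inv_iff_le_inv, tsub_le_iff_right, ENNReal.inv_two_add_inv_two]
    exact ENNReal.inv_le_one.2 hq1
  · rw [ENNReal.coe_toNNReal (ENNReal.inv_ne_top.2 hr0)]
    exact ⟨by rw [inv_inv, tsub_add_cancel_of_le hqi.le]⟩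

/-- Gradient estimate: an `L^1` bound on `Δu` controls `∇u` in `L^q` for `q < 2`. -/
theorem exists_eLpNorm_gradient_le (hΩ : Bornology.IsBounded (Ω : Set Plane)) {q : ℝ≥0∞}
    (hq1 : 1 ≤ q) (hq2 : q < 2) (C : ℝ≥0) : ∃ K : ℝ≥0, ∀ (u g : Plane → ℝ) (U : Plane → Plane),
      MemW10 Ω 2 u U → WeakDiv Ω U g → Integrable g (volOn Ω) → eLpNorm g 1 (volOn Ω) ≤ C →
      eLpNorm U q (volOn Ω) ≤ K := by
  have := isFiniteMeasure_volOn hΩ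
  obtain ⟨r, hr2', htr⟩ := exists_holderTriple_two hq1 hq2
  have hr2 : (2 : ℝ≥0∞) ≤ r := by exact_mod_cast hr2'
  -- The factor `1/v'` is quartic in `v` and is wanted in `L^r`, hence `v` is needed in `L^{4r}`.
  obtain ⟨S, hS⟩ := TestFunction.sobolev_two hΩ (m := r * 4)
    (hr2'.trans (le_mul_of_one_le_right zero_le (by norm_num)))
  set A : ℝ≥0∞ := ENNReal.ofReal (4 * (Real.pi / 2)) * C with hA
  set N : ℝ≥0∞ := A ^ (2 : ℝ)⁻¹ with hN
  have hNt : N ≠ ∞ := ENNReal.rpow_ne_top_of_nonneg (by norm_num)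
    (ENNReal.mul_ne_top ENNReal.ofReal_ne_top ENNReal.coe_ne_top)
  -- The two eights come from `4(1+v²)² ≤ 8 + 8v⁴`; `N` bounds `∇v` in `L²` and `S * N` bounds `v`
  -- in `L^{4r}`.
  set K : ℝ≥0∞ := (eLpNorm (fun _ : Plane => (8 : ℝ)) r (volOn Ω) + 8 * (S * N) ^ 4) * N with hK
  have hKt : K ≠ ∞ := by
    refine ENNReal.mul_ne_top (ENNReal.add_ne_top.2 ⟨(memLp_const _).2.ne, ?_⟩) hNt
    exact ENNReal.mul_ne_top (by simp) (ENNReal.pow_ne_top (ENNReal.mul_ne_top ENNReal.coe_ne_top hNt))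
  refine ⟨K.toNNReal, fun u g U hu hdiv hg hgC => ?_⟩
  rw [ENNReal.coe_toNNReal hKt]
  have hV := hu.comp (contDiff_powerSubst (3 / 8)) (powerSubst_zero _) (M := 1) fun t =>
    (abs_deriv_powerSubst_le (by norm_num) (by norm_num) t).trans
      (one_add_sq_rpow_neg_le_one (by norm_num) t)
  set v : Plane → ℝ := fun x => powerSubst (3 / 8) (u x) with hv
  set V : Plane → Plane := fun x => deriv (powerSubst (3 / 8)) (u x) • U x with hVdef
  have hVN : eLpNorm V 2 (volOn Ω) ≤ N := by
    have := hdiv.sq_eLpNorm_le hg hu (ψ := fun t => Real.arctan (powerSubst (1 / 4) t))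
      (Real.contDiff_arctan.comp (contDiff_powerSubst _)) (by simp [powerSubst_zero]) (M := 1)
      (B := Real.pi / 2) abs_deriv_arctan_powerSubst_le
      (fun t => abs_le.2 ⟨(Real.neg_pi_div_two_lt_arctan _).le, (Real.arctan_lt_pi_div_two _).le⟩)
      (by norm_num) sq_deriv_powerSubst_le
    have h2 : eLpNorm V 2 (volOn Ω) ^ 2 ≤ A := this.trans (by rw [hA]; gcongr)
    rw [hN, ENNReal.le_rpow_inv_iff (by norm_num)]
    simpa using h2
  have hvN : eLpNorm v (r * 4 : ℝ≥0) (volOn Ω) ≤ S * N :=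
    (hV.eLpNorm_le (by simp) hS).trans (by gcongr)
  set w : Plane → ℝ := fun x => (deriv (powerSubst (3 / 8)) (u x))⁻¹ with hw
  have hwm : AEStronglyMeasurable w (volOn Ω) :=
    (Continuous.inv₀ ((contDiff_powerSubst (3 / 8)).continuous_deriv (by simp))
      fun t => (inv_deriv_powerSubst_le t).1.ne').comp_aestronglyMeasurable hu.1.1.1
  have hUV : U = w • V := by
    ext1 x
    simp only [hw, hVdef, Pi.smul_apply']
    rw [inv_smul_smul₀ (inv_deriv_powerSubst_le _).1.ne']
  have hwN : eLpNorm w r (volOn Ω) ≤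
      eLpNorm (fun _ : Plane => (8 : ℝ)) r (volOn Ω) + 8 * (S * N) ^ 4 := by
    have hvm := hV.1.1.1
    calc _ ≤ eLpNorm ((fun _ => (8 : ℝ)) + (8 : ℝ) • fun x => ‖v x‖ ^ (4 : ℝ)) r (volOn Ω) := by
          refine eLpNorm_mono_real fun x => ?_
          obtain ⟨h1, h2⟩ := inv_deriv_powerSubst_le (u x)
          rw [Real.norm_of_nonneg (inv_nonneg.2 h1.le)]
          refine h2.trans ?_
          have : ‖v x‖ ^ (4 : ℝ) = v x ^ 4 := by
            rw [show (4 : ℝ) = (4 : ℕ) by norm_num, Real.rpow_natCast, Real.norm_eq_abs,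
              show 4 = 2 * 2 by rfl, pow_mul, sq_abs, pow_mul]
          simp only [Pi.add_apply, Pi.smul_apply, smul_eq_mul, this]
          simp only [hv]
          nlinarith [sq_nonneg (powerSubst (3 / 8) (u x) ^ 2 - 1)]
      _ ≤ _ := by
          refine (eLpNorm_add_le aestronglyMeasurable_const
            (((Real.continuous_rpow_const (q := (4 : ℝ)) (by norm_num)).comp_aestronglyMeasurable
              hvm.norm).const_smul _) (by exact one_le_two.trans hr2)).trans ?_
          gcongr
          rw [eLpNorm_const_smul, eLpNorm_norm_rpow _ (by norm_num)]
          have : (r : ℝ≥0∞) * ENNReal.ofReal 4 = ((r * 4 : ℝ≥0) : ℝ≥0∞) := by simp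
          rw [this]
          have e8 : ‖(8 : ℝ)‖ₑ = 8 := by simp [Real.enorm_eq_ofReal]
          rw [e8]
          gcongr
          rw [show (4 : ℝ) = (4 : ℕ) by norm_num, ENNReal.rpow_natCast]
          gcongr
  calc eLpNorm U q (volOn Ω) = eLpNorm (w • V) q (volOn Ω) := by rw [← hUV]
    _ ≤ eLpNorm w r (volOn Ω) * eLpNorm V 2 (volOn Ω) :=
        eLpNorm_smul_le_mul_eLpNorm hV.1.2.1.1 hwm
    _ ≤ K := by rw [hK]; gcongr

/-! ### Mollification and uniqueness of weak gradients. -/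

theorem norm_gradient_sub {f g : Plane → ℝ} (x : Plane) :
    ‖gradient f x - gradient g x‖ = ‖fderiv ℝ f x - fderiv ℝ g x‖ := by
  rw [← toDual_gradient, ← toDual_gradient, ← map_sub, LinearIsometryEquiv.norm_map]

/-- Mollification: a compactly supported `C^1` function is a `C^1` limit of test functions. -/
theorem exists_testFunction_near {v : Plane → ℝ} (hv : ContDiff ℝ 1 v) (hc : HasCompactSupport v)
    (hs : tsupport v ⊆ Ω) {ε : ℝ} (hε : 0 < ε) :
    ∃ φ : 𝓓(Ω, ℝ), ∀ x, ‖φ x - v x‖ ≤ ε ∧ ‖gradient φ x - gradient v x‖ ≤ ε := by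
  have hfc : Continuous (fderiv ℝ v) := hv.continuous_fderiv (by simp)
  obtain ⟨δ₁, h1, hδ₁⟩ := Metric.uniformContinuous_iff.1
    (hc.uniformContinuous_of_continuous hv.continuous) ε hε
  obtain ⟨δ₂, h2, hδ₂⟩ := Metric.uniformContinuous_iff.1
    ((hc.fderiv (𝕜 := ℝ)).uniformContinuous_of_continuous hfc) ε hε
  obtain ⟨δ₃, h3, hδ₃⟩ := hc.isCompact.exists_cthickening_subset_open Ω.isOpen hs
  -- One radius serves three purposes: uniform continuity of `v`, uniform continuity of its
  -- derivative, and keeping the mollified support inside `Ω`.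
  set δ := min δ₁ (min δ₂ δ₃) with hδ
  have hδ0 : 0 < δ := lt_min h1 (lt_min h2 h3)
  set ρ : ContDiffBump (0 : Plane) := ⟨δ / 2, δ, half_pos hδ0, half_lt_self hδ0⟩
  have hρδ : ρ.rOut = δ := rfl
  set η := MeasureTheory.convolution (ρ.normed volume) v (ContinuousLinearMap.lsmul ℝ ℝ) volume
    with hη
  have hvi : LocallyIntegrable v volume := hv.continuous.locallyIntegrable
  have hsupp : tsupport η ⊆ Metric.cthickening δ (tsupport v) := by
    refine closure_minimal ?_ Metric.isClosed_cthickening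
    refine (support_convolution_subset _).trans ?_
    rw [ρ.support_normed_eq]
    rintro _ ⟨a, ha, b, hb, rfl⟩
    refine Metric.mem_cthickening_of_dist_le _ b _ _ (subset_tsupport _ hb) ?_
    rw [Metric.mem_ball, hρδ] at ha
    simpa using ha.le
  refine ⟨⟨η, ρ.hasCompactSupport_normed.contDiff_convolution_left _ ρ.contDiff_normed hvi,
    ρ.hasCompactSupport_normed.convolution _ hc, hsupp.trans
      ((Metric.cthickening_mono ((min_le_right _ _).trans (min_le_right _ _)) _).trans hδ₃)⟩,
      fun x => ⟨?_, ?_⟩⟩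
  · rw [← dist_eq_norm]
    refine ρ.dist_normed_convolution_le hvi.aestronglyMeasurable fun y hy => ?_
    exact (hδ₁ (hy.trans_le (min_le_left _ _))).le
  · rw [norm_gradient_sub, ← dist_eq_norm]
    -- The derivative is put on `v`, so the gradient of the mollification is the mollification of
    -- the gradient.
    have hd := hc.hasFDerivAt_convolution_right (ContinuousLinearMap.lsmul ℝ ℝ)
      ((ρ.continuous_normed (μ := volume)).locallyIntegrable (μ := volume)) hv x
    rw [TestFunction.coe_mk, hd.fderiv]
    exact ρ.dist_normed_convolution_le (μ := volume) hfc.aestronglyMeasurable fun y hy =>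
      (hδ₂ (hy.trans_le ((min_le_right _ _).trans (min_le_left _ _)))).le

theorem LocallyIntegrableOn.integrableOn_mul {h η : Plane → ℝ}
    (hh : LocallyIntegrableOn h Ω volume) (hη : Continuous η) (hc : HasCompactSupport η)
    (hs : tsupport η ⊆ Ω) : IntegrableOn (fun x => h x * η x) Ω volume := by
  obtain ⟨M, hM⟩ := hc.exists_bound_of_continuous hη
  have h1 : IntegrableOn (fun x => h x * η x) (tsupport η) volume :=
    Integrable.mul_bdd (hh.integrableOn_compact_subset hs hc) hη.aestronglyMeasurable
      (.of_forall hM)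
  refine ((integrableOn_iff_integrable_of_support_subset fun x hx => ?_).1 h1).integrableOn
  exact subset_tsupport _ (right_ne_zero_of_mul hx)

theorem ae_eq_of_integral_testFunction {f g : Plane → ℝ} (hf : LocallyIntegrableOn f Ω volume)
    (hg : LocallyIntegrableOn g Ω volume)
    (h : ∀ φ : 𝓓(Ω, ℝ), ∫ x in (Ω : Set Plane), f x * φ x = ∫ x in (Ω : Set Plane), g x * φ x) :
    f =ᵐ[volOn Ω] g := by
  have := Ω.isOpen.ae_eq_zero_of_integral_contDiff_smul_eq_zero (hf.sub hg) fun φ h1 h2 h3 => by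
    let η : 𝓓(Ω, ℝ) := ⟨φ, h1, h2, h3⟩
    have e : ∫ x in (Ω : Set Plane), f x * φ x = ∫ x in (Ω : Set Plane), g x * φ x := h η
    rw [← sub_eq_zero, ← integral_sub (LocallyIntegrableOn.integrableOn_mul hf h1.continuous h2 h3)
      (LocallyIntegrableOn.integrableOn_mul hg h1.continuous h2 h3)] at e
    rw [← e, setIntegral_eq_integral_of_forall_compl_eq_zero]
    · refine integral_congr_ae (.of_forall fun x => ?_)
      change φ x * (f x - g x) = f x * φ x - g x * φ x
      ring
    · intro x hx
      have : φ x = 0 := η.apply_eq_zero hx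
      simp [this]
  rw [Filter.EventuallyEq, ae_restrict_iff' Ω.isOpen.measurableSet]
  filter_upwards [this] with x hx h
  exact sub_eq_zero.1 (hx h)

theorem LocallyIntegrableOn.inner_const {G : Plane → Plane} (hG : LocallyIntegrableOn G Ω volume)
    (v : Plane) : LocallyIntegrableOn (fun x => inner ℝ (G x) v) Ω volume := by
  rw [locallyIntegrableOn_iff Ω.isOpen.isLocallyClosed] at hG ⊢
  exact fun K hK hc => (hG K hK hc).inner_const v

/-- Weak gradients are unique. -/
theorem HasWeakGradient.ae_eq {u : Plane → ℝ} {G G' : Plane → Plane}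
    (h : HasWeakGradient Ω u G) (h' : HasWeakGradient Ω u G') : G =ᵐ[volOn Ω] G' := by
  have key : ∀ i : Fin 2, (fun x => inner ℝ (G x) (EuclideanSpace.basisFun (Fin 2) ℝ i)) =ᵐ[volOn Ω]
      fun x => inner ℝ (G' x) (EuclideanSpace.basisFun (Fin 2) ℝ i) := fun i =>
    ae_eq_of_integral_testFunction (LocallyIntegrableOn.inner_const h.2.1 _)
      (LocallyIntegrableOn.inner_const h'.2.1 _)
      fun φ => neg_injective ((h.2.2 φ _).symm.trans (h'.2.2 φ _))
  filter_upwards [ae_all_iff.2 key] with x hx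
  ext i
  simpa [EuclideanSpace.basisFun_apply, EuclideanSpace.inner_single_right] using hx i

theorem MemW10.congr {p : ℝ≥0∞} {u : Plane → ℝ} {U U' : Plane → Plane}
    (hu : MemW10 Ω p u U) (h : U =ᵐ[volOn Ω] U') [IsFiniteMeasure (volOn Ω)] (hp : 1 ≤ p) :
    MemW10 Ω p u U' := by
  obtain ⟨⟨hu1, hu2, -⟩, φ, h1, h2⟩ := hu
  refine .of_tendsto hp hu1 (hu2.ae_eq h) φ h1 (h2.congr fun n => eLpNorm_congr_ae ?_)
  filter_upwards [h] with x hx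
  rw [hx]

/-! ### From the weak Laplacian to divergence form. -/

/-- The directional derivative of a test function. -/
noncomputable def TestFunction.dirDeriv (φ : 𝓓(Ω, ℝ)) (v : Plane) : 𝓓(Ω, ℝ) :=
  ⟨fun x => fderiv ℝ φ x v,
    (φ.contDiff.fderiv_right (m := (⊤ : ℕ∞)) (by simp)).clm_apply contDiff_const,
    (φ.hasCompactSupport.fderiv (𝕜 := ℝ)).comp_left (g := fun L : Plane →L[ℝ] ℝ => L v) (by simp),
    ((tsupport_comp_subset (g := fun L : Plane →L[ℝ] ℝ => L v) (by simp) _).trans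
      (tsupport_fderiv_subset ℝ)).trans φ.tsupport_subset⟩

theorem TestFunction.dirDeriv_apply (φ : 𝓓(Ω, ℝ)) (v x : Plane) :
    φ.dirDeriv v x = inner ℝ (gradient φ x) v := inner_gradient_left.symm

theorem TestFunction.laplacian_apply (φ : 𝓓(Ω, ℝ)) (x : Plane) :
    Δ (φ : Plane → ℝ) x = ∑ i, inner ℝ (gradient (φ.dirDeriv (EuclideanSpace.basisFun (Fin 2) ℝ i)) x)
      (EuclideanSpace.basisFun (Fin 2) ℝ i) := by
  rw [InnerProductSpace.laplacian_eq_iteratedFDeriv_orthonormalBasis φ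
    (EuclideanSpace.basisFun (Fin 2) ℝ)]
  refine Finset.sum_congr rfl fun i _ => ?_
  rw [iteratedFDeriv_two_apply, inner_gradient_left]
  have : ((φ.dirDeriv (EuclideanSpace.basisFun (Fin 2) ℝ i) : 𝓓(Ω, ℝ)) : Plane → ℝ) =
    fun x => fderiv ℝ φ x (EuclideanSpace.basisFun (Fin 2) ℝ i) := rfl
  rw [this, fderiv_clm_apply ((φ.contDiff.fderiv_right (m := (⊤ : ℕ∞)) (by simp)).differentiable
    (by simp) x) (differentiableAt_const _)]
  simp

/-- Testing the weak gradient against `∇φ` gives the weak Laplacian. -/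
theorem HasWeakGradient.integral_laplacian {u : Plane → ℝ} {G : Plane → Plane}
    (h : HasWeakGradient Ω u G) (φ : 𝓓(Ω, ℝ)) :
    ∫ x in (Ω : Set Plane), u x * Δ (φ : Plane → ℝ) x =
      - ∑ i, ∫ x in (Ω : Set Plane), inner ℝ (G x) (EuclideanSpace.basisFun (Fin 2) ℝ i) *
        φ.dirDeriv (EuclideanSpace.basisFun (Fin 2) ℝ i) x := by
  simp only [TestFunction.laplacian_apply, Finset.mul_sum]
  rw [integral_finsetSum, ← Finset.sum_neg_distrib]
  · exact Finset.sum_congr rfl fun i _ => h.2.2 _ _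
  · intro i _
    simp only [← TestFunction.dirDeriv_apply]
    exact LocallyIntegrableOn.integrableOn_mul h.1 (TestFunction.continuous _)
      (TestFunction.hasCompactSupport _) (TestFunction.tsupport_subset _)

/-- Each `∂_iφ` is again a test function; inserting it into the weak gradient identity and summing
over an orthonormal basis turns `∫ u Δφ` into `-∫ G·∇φ`. -/
theorem HasWeakLaplacian.weakDiv {u L : Plane → ℝ} {G : Plane → Plane} (hL : HasWeakLaplacian Ω u L)
    (h : HasWeakGradient Ω u G) : WeakDiv Ω G (fun x => -L x) := by
  intro φ
  simp only [neg_mul]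
  rw [integral_neg, ← hL.2.2 φ, h.integral_laplacian, neg_neg, ← integral_finsetSum]
  · refine integral_congr_ae (.of_forall fun x => ?_)
    simp only [TestFunction.dirDeriv_apply]
    rw [← (EuclideanSpace.basisFun (Fin 2) ℝ).sum_inner_mul_inner]
    exact Finset.sum_congr rfl fun i _ => by rw [real_inner_comm (gradient φ x)]
  · exact fun i _ => LocallyIntegrableOn.integrableOn_mul
      (LocallyIntegrableOn.inner_const h.2.1 _) (TestFunction.continuous _)
      (TestFunction.hasCompactSupport _) (TestFunction.tsupport_subset _)

/-- The trace of the weak second derivatives is in `L^k`, hence integrable, and acts on test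
functions as `L` does, so the two agree almost everywhere. -/
theorem MemW2.integrable_laplacian [IsFiniteMeasure (volOn Ω)] {k : ℝ≥0∞} (hk : 1 ≤ k)
    {u L : Plane → ℝ} (hu : MemW2 Ω k u) (hL : HasWeakLaplacian Ω u L) :
    Integrable L (volOn Ω) := by
  obtain ⟨G, ⟨-, -, hG⟩, hH⟩ := hu
  choose H hH using hH
  have hint : ∀ i, Integrable (fun x => inner ℝ (H i x) (EuclideanSpace.basisFun (Fin 2) ℝ i))
      (volOn Ω) := fun i => ((hH i).2.1.inner_const _).integrable hk
  have hsum : Integrable (fun x => ∑ i, inner ℝ (H i x) (EuclideanSpace.basisFun (Fin 2) ℝ i))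
      (volOn Ω) := integrable_finsetSum _ fun i _ => hint i
  refine hsum.congr (ae_eq_of_integral_testFunction
    (LocallyIntegrableOn.of_memLp le_rfl (memLp_one_iff_integrable.2 hsum)) hL.2.1 fun φ => ?_)
  rw [← hL.2.2 φ, hG.integral_laplacian φ, ← Finset.sum_neg_distrib]
  simp only [Finset.sum_mul]
  rw [integral_finsetSum]
  · refine Finset.sum_congr rfl fun i _ => ?_
    have := (hH i).2.2.2.2 φ (EuclideanSpace.basisFun (Fin 2) ℝ i)
    rw [← neg_eq_iff_eq_neg] at this
    rw [← this]
    simp [TestFunction.dirDeriv_apply, EuclideanSpace.basisFun_apply, EuclideanSpace.inner_single_right]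
  · obtain ⟨M, hM⟩ := φ.exists_norm_le
    exact fun i _ => (hint i).mul_bdd φ.continuous.aestronglyMeasurable (.of_forall hM)

/-! ### The Dirichlet class lies in `W_0^{1,2}`. -/

/-- Smooth truncations of the identity. -/
theorem exists_smooth_truncation {R : ℝ} (hR : 0 < R) :
    ∃ (τ : ℝ → ℝ) (M B : ℝ), ContDiff ℝ (⊤ : ℕ∞) τ ∧ (∀ t, |t| ≤ R → τ t = t) ∧
      (∀ t, R + 1 ≤ |t| → τ t = 0) ∧ (∀ t, |deriv τ t| ≤ M) ∧ ∀ t, |τ t| ≤ B := by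
  let b : ContDiffBump (0 : ℝ) := ⟨R, R + 1, hR, lt_add_one R⟩
  have hτ : ContDiff ℝ (⊤ : ℕ∞) fun t => t * b t := contDiff_id.mul b.contDiff
  have hc : HasCompactSupport fun t => t * b t := b.hasCompactSupport.mul_left
  obtain ⟨B, hB⟩ := hc.exists_bound_of_continuous hτ.continuous
  obtain ⟨M, hM⟩ := hc.deriv.exists_bound_of_continuous (hτ.continuous_deriv (by simp))
  refine ⟨_, M, B, hτ, fun t ht => ?_, fun t ht => ?_, hM, hB⟩
  · rw [b.one_of_mem_closedBall (by simpa using ht), mul_one]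
  · rw [b.zero_of_le_dist (by simpa using ht), mul_zero]

/-- Composing with a function vanishing near `0` gives a compactly supported `C^1` function. -/
theorem contDiff_indicator_comp (hΩ : Bornology.IsBounded (Ω : Set Plane)) {u : Plane → ℝ}
    {D : Plane → Plane} (hu : ContinuousOn u (closure (Ω : Set Plane)))
    (hu0 : ∀ x ∈ frontier (Ω : Set Plane), u x = 0) (hD : ∀ x ∈ Ω, HasGradientAt u (D x) x)
    (hDc : ContinuousOn D Ω) {ψ : ℝ → ℝ} (hψ : ContDiff ℝ (⊤ : ℕ∞) ψ) {δ : ℝ} (hδ : 0 < δ)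
    (h0 : ∀ t, |t| ≤ δ → ψ t = 0) :
    ContDiff ℝ 1 ((Ω : Set Plane).indicator (ψ ∘ u)) ∧
    HasCompactSupport ((Ω : Set Plane).indicator (ψ ∘ u)) ∧
    tsupport ((Ω : Set Plane).indicator (ψ ∘ u)) ⊆ Ω ∧
    ∀ x ∈ Ω, gradient ((Ω : Set Plane).indicator (ψ ∘ u)) x = deriv ψ (u x) • D x := by
  set v := (Ω : Set Plane).indicator (ψ ∘ u) with hv
  -- `K` is compact and misses the boundary, where `u = 0`; it contains the support of `ψ ∘ u`
  -- because `ψ` vanishes on `[-δ, δ]`.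
  set K : Set Plane := closure (Ω : Set Plane) ∩ u ⁻¹' {t | δ ≤ |t|} with hK
  have hKc : IsClosed K := hu.preimage_isClosed_of_isClosed isClosed_closure
    (isClosed_le continuous_const continuous_abs)
  have hKΩ : K ⊆ Ω := fun x hx => by
    by_contra hxΩ
    have : u x = 0 := hu0 x (by rw [Ω.isOpen.frontier_eq]; exact ⟨hx.1, hxΩ⟩)
    have h2 : δ ≤ |u x| := hx.2
    rw [this, abs_zero] at h2
    linarith
  have hts : tsupport v ⊆ K := by
    refine closure_minimal (fun x hx => ?_) hKc
    have hxΩ : x ∈ (Ω : Set Plane) := mem_of_indicator_ne_zero hx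
    refine ⟨subset_closure hxΩ, ?_⟩
    by_contra hlt
    refine hx ?_
    rw [hv, indicator_of_mem hxΩ]
    exact h0 _ (not_le.1 hlt).le
  have hKcomp : IsCompact K := Metric.isCompact_of_isClosed_isBounded hKc
    (hΩ.closure.subset inter_subset_left)
  have hloc : ∀ x ∈ (Ω : Set Plane), v =ᶠ[𝓝 x] ψ ∘ u := fun x hx => by
    filter_upwards [Ω.isOpen.mem_nhds hx] with y hy
    exact indicator_of_mem hy _
  have hudiff : ContDiffOn ℝ 1 u Ω := by
    rw [show (1 : WithTop ℕ∞) = 0 + 1 from rfl, contDiffOn_succ_iff_fderiv_of_isOpen Ω.isOpen]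
    refine ⟨fun x hx => (hD x hx).differentiableAt.differentiableWithinAt, by simp, ?_⟩
    rw [contDiffOn_zero]
    refine ((InnerProductSpace.toDual ℝ Plane).continuous.comp_continuousOn hDc).congr ?_
    exact fun x hx => (hasGradientAt_iff_hasFDerivAt.1 (hD x hx)).fderiv
  refine ⟨contDiff_iff_contDiffAt.2 fun x => ?_, hKcomp.of_isClosed_subset (isClosed_tsupport _) hts,
    hts.trans hKΩ, fun x hx => ?_⟩
  · by_cases hx : x ∈ (Ω : Set Plane)
    · exact (((hψ.of_le (by exact_mod_cast le_top)).contDiffAt).comp x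
        (hudiff.contDiffAt (Ω.isOpen.mem_nhds hx))).congr_of_eventuallyEq (hloc x hx)
    · have : v =ᶠ[𝓝 x] fun _ => 0 := by
        filter_upwards [hKc.isOpen_compl.mem_nhds fun h => hx (hKΩ h)] with y hy
        exact image_eq_zero_of_notMem_tsupport fun h => hy (hts h)
      exact contDiffAt_const.congr_of_eventuallyEq this
  · rw [(hloc x hx).gradient_eq]
    refine HasGradientAt.gradient ?_
    rw [hasGradientAt_iff_hasFDerivAt]
    have := ((hψ.differentiable (by simp)) (u x)).hasDerivAt.comp_hasFDerivAt x
      (hasGradientAt_iff_hasFDerivAt.1 (hD x hx))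
    simpa using this

theorem eLpNorm_le_ofReal_mul {E : Type*} [NormedAddCommGroup E] {μ : Measure Plane} {p : ℝ≥0∞}
    {F : Plane → E} {c : ℝ} (h : ∀ᵐ x ∂μ, ‖F x‖ ≤ c) :
    eLpNorm F p μ ≤ ENNReal.ofReal c * eLpNorm (fun _ => (1 : ℝ)) p μ :=
  eLpNorm_le_mul_eLpNorm_of_ae_le_mul (h.mono fun x hx => by simpa using hx) p

theorem tendsto_eLpNorm_of_norm_le {E : Type*} [NormedAddCommGroup E] {μ : Measure Plane}
    [IsFiniteMeasure μ] {p : ℝ≥0∞} {F : ℕ → Plane → E} {c : ℕ → ℝ}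
    (h : ∀ n, ∀ᵐ x ∂μ, ‖F n x‖ ≤ c n) (hc : Tendsto c atTop (𝓝 0)) :
    Tendsto (fun n => eLpNorm (F n) p μ) atTop (𝓝 0) := by
  refine tendsto_zero_of_le (tendsto_const_mul_zero (c := eLpNorm (fun _ => (1 : ℝ)) p μ)
    (memLp_const _).2.ne (a := fun n => ENNReal.ofReal (c n)) ?_) fun n => ?_
  · simpa using (ENNReal.tendsto_ofReal hc)
  · rw [mul_comm]; exact eLpNorm_le_ofReal_mul (h n)

/-- A `C^1` function on `Ω` with bounded gradient which is continuous up to the boundary and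
vanishes there belongs to `W_0^{1,2}`. -/
theorem memW10_of_continuousOn (hΩ : Bornology.IsBounded (Ω : Set Plane)) {u : Plane → ℝ}
    {D : Plane → Plane} (hu : ContinuousOn u (closure (Ω : Set Plane)))
    (hu0 : ∀ x ∈ frontier (Ω : Set Plane), u x = 0) (hD : ∀ x ∈ Ω, HasGradientAt u (D x) x)
    (hDc : ContinuousOn D Ω) {B : ℝ} (hB : ∀ x ∈ Ω, ‖D x‖ ≤ B) : MemW10 Ω 2 u D := by
  have := isFiniteMeasure_volOn hΩ
  have hΩm : MeasurableSet (Ω : Set Plane) := Ω.isOpen.measurableSet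
  obtain ⟨τ, M, T, hτ, hτ1, hτ2, hM, hT⟩ := exists_smooth_truncation one_pos
  obtain ⟨Bu, hBu⟩ := hΩ.isCompact_closure.exists_bound_of_continuousOn hu
  have hae : ∀ {P : Plane → Prop}, (∀ x ∈ Ω, P x) → ∀ᵐ x ∂(volOn Ω), P x := fun h =>
    (ae_restrict_iff' hΩm).2 (.of_forall h)
  have hum : AEStronglyMeasurable u (volOn Ω) :=
    (hu.mono subset_closure).aestronglyMeasurable hΩm
  have hDm : AEStronglyMeasurable D (volOn Ω) := hDc.aestronglyMeasurable hΩm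
  have hup : MemLp u 2 (volOn Ω) := .of_bound hum Bu (hae fun x hx => hBu x (subset_closure hx))
  have hDp : MemLp D 2 (volOn Ω) := .of_bound hDm B (hae hB)
  -- `ψ_n(t) = t - τ((n+1)t)/(n+1)` vanishes for `|t| ≤ 1/(n+1)`, is uniformly within `T/(n+1)` of
  -- the identity, and has derivative bounded independently of `n`.
  set ψ : ℕ → ℝ → ℝ := fun n t => (n + 1 : ℝ)⁻¹ * (((n + 1) * t) - τ ((n + 1) * t)) with hψdef
  have hn : ∀ n : ℕ, (0 : ℝ) < n + 1 := fun n => by positivity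
  have hψ : ∀ n, ContDiff ℝ (⊤ : ℕ∞) (ψ n) := fun n => by
    have : ContDiff ℝ (⊤ : ℕ∞) fun t : ℝ => (n + 1 : ℝ) * t := contDiff_const.mul contDiff_id
    exact contDiff_const.mul (this.sub (hτ.comp this))
  have hψ0 : ∀ (n : ℕ) (t : ℝ), |t| ≤ (n + 1 : ℝ)⁻¹ → ψ n t = 0 := fun n t ht => by
    have : |(n + 1) * t| ≤ 1 := by
      rw [abs_mul, abs_of_pos (hn n)]
      exact (mul_le_mul_of_nonneg_left ht (hn n).le).trans_eq (mul_inv_cancel₀ (hn n).ne')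
    simp only [hψdef, hτ1 _ this, sub_self, mul_zero]
  have hψ' : ∀ n t, deriv (ψ n) t = 1 - deriv τ ((n + 1) * t) := fun n t => by
    have h1 : HasDerivAt (fun t : ℝ => (n + 1 : ℝ) * t) (n + 1) t := by
      simpa using (hasDerivAt_id t).const_mul (n + 1 : ℝ)
    have h2 := (hτ.differentiable (by simp) ((n + 1) * t)).hasDerivAt.comp t h1
    refine ((h1.sub h2).const_mul (n + 1 : ℝ)⁻¹).deriv.trans ?_
    have := (hn n).ne'
    field_simp
  have hψu : ∀ (n : ℕ) (t : ℝ), |ψ n t - t| ≤ T / (n + 1) := fun n t => by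
    have : ψ n t - t = - (τ ((n + 1) * t) / (n + 1)) := by
      simp only [hψdef]; have := (hn n).ne'; field_simp; ring
    rw [this, abs_neg, abs_div, abs_of_pos (hn n)]
    gcongr; exact hT _
  have happ : ∀ n, ∃ φ : 𝓓(Ω, ℝ), ∀ x ∈ Ω, ‖φ x - ψ n (u x)‖ ≤ (n + 1 : ℝ)⁻¹ ∧
      ‖gradient φ x - deriv (ψ n) (u x) • D x‖ ≤ (n + 1 : ℝ)⁻¹ := fun n => by
    obtain ⟨h1, h2, h3, h4⟩ := contDiff_indicator_comp hΩ hu hu0 hD hDc (hψ n)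
      (inv_pos.2 (hn n)) (hψ0 n)
    obtain ⟨φ, hφ⟩ := exists_testFunction_near h1 h2 h3 (inv_pos.2 (hn n))
    refine ⟨φ, fun x hx => ⟨?_, ?_⟩⟩
    · have := (hφ x).1
      rwa [indicator_of_mem (show x ∈ (Ω : Set Plane) from hx)] at this
    · rw [← h4 x hx]; exact (hφ x).2
  choose φ hφ using happ
  have hinv : Tendsto (fun n : ℕ => (n + 1 : ℝ)⁻¹) atTop (𝓝 0) := by
    simpa using tendsto_one_div_add_atTop_nhds_zero_nat (𝕜 := ℝ)
  -- The gradients of `ψ_n(u)` converge to `D` only off the zero set of `u`; on it they vanish,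
  -- since `τ'(0) = 1`.
  set D' : Plane → Plane := {x | u x ≠ 0}.indicator D with hD'
  have hset : NullMeasurableSet {x | u x ≠ 0} (volOn Ω) :=
    (hum.nullMeasurableSet_eq_fun aestronglyMeasurable_const).compl
  have hD'p : MemLp D' 2 (volOn Ω) := hDp.of_le (hDm.indicator₀ hset)
    (.of_forall fun x => norm_indicator_le_norm_self _ _)
  have hlim : Tendsto (fun n => eLpNorm (fun x => deriv (ψ n) (u x) • D x - D' x) 2 (volOn Ω))
      atTop (𝓝 0) := by
    refine tendsto_eLpNorm_of_dominated (by simp) (by simp) (b := fun _ => (1 + M) * B + B)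
      (fun n => ((((hψ n).continuous_deriv (by simp)).comp_aestronglyMeasurable hum).smul
        hDm).sub hD'p.1) (memLp_const _) (fun n => hae fun x hx => ?_) (.of_forall fun x => ?_)
    · have hB0 : 0 ≤ B := (norm_nonneg _).trans (hB x hx)
      refine (norm_sub_le _ _).trans (add_le_add ?_
        ((norm_indicator_le_norm_self _ _).trans (hB x hx)))
      rw [norm_smul, hψ', Real.norm_eq_abs]
      have := (abs_sub _ _).trans (add_le_add (abs_one (α := ℝ)).le (hM ((n + 1) * u x)))
      exact mul_le_mul this (hB x hx) (norm_nonneg _) ((abs_nonneg _).trans this)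
    · refine tendsto_const_nhds.congr' ?_
      by_cases hx : u x = 0
      · have hd0 : deriv τ 0 = 1 := by
          have : τ =ᶠ[𝓝 0] id := by
            filter_upwards [Metric.ball_mem_nhds (0 : ℝ) one_pos] with t ht
            exact hτ1 t (by simpa using (Metric.mem_ball.1 ht).le)
          rw [this.deriv_eq, deriv_id]
        refine .of_forall fun n => ?_
        simp [hψ', hx, hd0, hD']
      · have hlarge : Tendsto (fun n : ℕ => (n + 1 : ℝ) * |u x|) atTop atTop :=
          (tendsto_atTop_add_const_right _ _ tendsto_natCast_atTop_atTop).atTop_mul_const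
            (abs_pos.2 hx)
        filter_upwards [hlarge.eventually_gt_atTop 2] with n hn2
        have hd0 : deriv τ ((n + 1) * u x) = 0 := by
          have : τ =ᶠ[𝓝 ((n + 1) * u x)] fun _ => 0 := by
            have : ∀ᶠ t in 𝓝 ((n + 1) * u x), 2 < |t| := by
              refine continuous_abs.continuousAt.eventually_const_lt ?_
              rwa [abs_mul, abs_of_pos (hn n)]
            filter_upwards [this] with t ht
            exact hτ2 t (by linarith)
          rw [this.deriv_eq, deriv_const]
        simp [hψ', hd0, hD', indicator_of_mem (show x ∈ {x | u x ≠ 0} from hx)]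
  have hW : MemW10 Ω 2 u D' := by
    refine .of_tendsto (by simp) hup hD'p φ ?_ ?_
    · refine tendsto_eLpNorm_of_norm_le (c := fun n => (n + 1 : ℝ)⁻¹ + T * (n + 1 : ℝ)⁻¹)
        (fun n => hae fun x hx => ?_) (by simpa using hinv.add (hinv.const_mul T))
      calc ‖φ n x - u x‖ = ‖(φ n x - ψ n (u x)) + (ψ n (u x) - u x)‖ := by congr 1; ring
        _ ≤ _ := (norm_add_le _ _).trans (add_le_add (hφ n x hx).1 (hψu n _))
    · have h1 := tendsto_eLpNorm_of_norm_le (μ := volOn Ω) (p := 2)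
        (fun n => hae fun x hx => (hφ n x hx).2) hinv
      have h2 := h1.add hlim
      rw [add_zero] at h2
      refine tendsto_zero_of_le h2 fun n => ?_
      refine (eLpNorm_congr_ae (.of_forall fun x => ?_)).trans_le (eLpNorm_add_le
        (((φ n).memLp_gradient 2).1.sub
          ((((hψ n).continuous_deriv (by simp)).comp_aestronglyMeasurable hum).smul hDm))
        (((((hψ n).continuous_deriv (by simp)).comp_aestronglyMeasurable hum).smul
          hDm).sub hD'p.1) (by simp))
      simp
  have hweak : HasWeakGradient Ω u D := ⟨.of_memLp (p := 2) (by simp) hup,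
    .of_memLp (p := 2) (by simp) hDp, fun η v => η.integral_mul_inner_gradient hD hDc v⟩
  -- `D'` and `D` are both weak gradients of `u`, so uniqueness removes the indicator without a
  -- separate study of the zero set.
  exact hW.congr (hW.1.2.2.ae_eq hweak) (by simp)

/-- Because `ε > 0`, the Hölder extension of the gradient is continuous on the compact closure and
therefore bounded. -/
theorem DirichletClass.memW10 (hΩ : Bornology.IsBounded (Ω : Set Plane)) {k : ℝ≥0∞} {ε : ℝ≥0}
    (hε : 0 < ε) {u : Plane → ℝ} (hu : DirichletClass Ω k ε u) : MemW10 Ω 2 u (gradient u) := by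
  have := isFiniteMeasure_volOn hΩ
  obtain ⟨-, ⟨hc, D, hD, M, hM⟩, h0⟩ := hu
  have hDc := hM.continuousOn hε
  obtain ⟨B, hB⟩ := hΩ.isCompact_closure.exists_bound_of_continuousOn hDc
  refine (memW10_of_continuousOn hΩ hc h0 hD (hDc.mono subset_closure)
    fun x hx => hB x (subset_closure hx)).congr ?_ (by simp)
  rw [Filter.EventuallyEq, ae_restrict_iff' Ω.isOpen.measurableSet]
  exact .of_forall fun x hx => (hD x hx).gradient.symm

/-! ### Existence by Lax-Milgram. -/

/-- The Hilbert space `L²(Ω) × L²(Ω; ℝ²)`. -/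
abbrev L2Pair (Ω : Opens Plane) : Type :=
  WithLp 2 (Lp ℝ 2 (volOn Ω) × Lp Plane 2 (volOn Ω))

/-- The map `φ ↦ (φ, ∇φ)`. -/
noncomputable def testGraph (Ω : Opens Plane) : 𝓓(Ω, ℝ) →ₗ[ℝ] L2Pair Ω where
  toFun φ := WithLp.toLp 2 ((φ.memLp 2).toLp φ, (φ.memLp_gradient 2).toLp (gradient φ))
  map_add' φ η := by
    rw [← WithLp.toLp_add, Prod.mk_add_mk, ← MemLp.toLp_add, ← MemLp.toLp_add]
    congr 2
    exact MemLp.toLp_congr _ _ (.of_forall fun x => TestFunction.gradient_add φ η x)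
  map_smul' c φ := by
    rw [RingHom.id_apply, ← WithLp.toLp_smul, Prod.smul_mk, ← MemLp.toLp_const_smul,
      ← MemLp.toLp_const_smul]
    congr 2
    exact MemLp.toLp_congr _ _ (.of_forall fun x => TestFunction.gradient_smul c φ x)

/-- Poincaré's inequality is a closed condition on pairs, so it survives the closure; it makes the
Dirichlet form coercive. -/
theorem exists_testFunction_poincare (hΩ : Bornology.IsBounded (Ω : Set Plane)) :
    ∃ S : ℝ, 0 ≤ S ∧ ∀ w ∈ (LinearMap.range (testGraph Ω)).topologicalClosure,
      ‖w.fst‖ ≤ S * ‖w.snd‖ := by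
  obtain ⟨S, hS⟩ := TestFunction.sobolev_two hΩ (m := 2) le_rfl
  refine ⟨S, S.2, fun w hw => ?_⟩
  have hcl : IsClosed {w : L2Pair Ω | ‖w.fst‖ ≤ S * ‖w.snd‖} :=
    isClosed_le (WithLp.fstL 2 ℝ _ _).continuous.norm
      (continuous_const.mul (WithLp.sndL 2 ℝ _ _).continuous.norm)
  refine closure_minimal ?_ hcl (show w ∈ closure _ from hw)
  rintro _ ⟨φ, rfl⟩
  change ‖(φ.memLp 2).toLp φ‖ ≤ S * ‖(φ.memLp_gradient 2).toLp (gradient φ)‖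
  rw [Lp.norm_toLp, Lp.norm_toLp]
  have := ENNReal.toReal_mono (ENNReal.mul_ne_top ENNReal.coe_ne_top (φ.memLp_gradient 2).2.ne)
    (hS φ)
  simpa using this

theorem memW10_of_mem_closure [IsFiniteMeasure (volOn Ω)] {w : L2Pair Ω}
    (hw : w ∈ (LinearMap.range (testGraph Ω)).topologicalClosure) : MemW10 Ω 2 w.fst w.snd := by
  obtain ⟨s, hs, hlim⟩ := mem_closure_iff_seq_limit.1 (show w ∈ closure _ from hw)
  choose φ hφ using hs
  have h1 := (((WithLp.fstL 2 ℝ _ _).continuous.tendsto w).comp hlim)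
  have h2 := (((WithLp.sndL 2 ℝ _ _).continuous.tendsto w).comp hlim)
  rw [Lp.tendsto_Lp_iff_tendsto_eLpNorm'] at h1 h2
  refine .of_tendsto (by simp) (Lp.memLp _) (Lp.memLp _) φ (h1.congr fun n => ?_)
    (h2.congr fun n => ?_)
  · refine eLpNorm_congr_ae ?_
    simp only [Function.comp_apply, ← hφ]
    filter_upwards [((φ n).memLp 2).coeFn_toLp] with x hx
    simp only [Pi.sub_apply]
    rw [← hx]; rfl
  · refine eLpNorm_congr_ae ?_
    simp only [Function.comp_apply, ← hφ]
    filter_upwards [((φ n).memLp_gradient 2).coeFn_toLp] with x hx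
    simp only [Pi.sub_apply]
    rw [← hx]; rfl

/-- Existence of a weak solution `z ∈ W_0^{1,2}` of `-Δz = g + div f`. -/
theorem exists_weak_solution (hΩ : Bornology.IsBounded (Ω : Set Plane)) {g : Plane → ℝ}
    {f : Plane → Plane} (hg : MemLp g 2 (volOn Ω)) (hf : MemLp f 2 (volOn Ω)) :
    ∃ (z : Plane → ℝ) (Z : Plane → Plane), MemW10 Ω 2 z Z ∧ ∀ φ : 𝓓(Ω, ℝ),
      ∫ x in (Ω : Set Plane), inner ℝ (Z x) (gradient φ x) =
        (∫ x in (Ω : Set Plane), g x * φ x) -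
          ∫ x in (Ω : Set Plane), inner ℝ (f x) (gradient φ x) := by
  have := isFiniteMeasure_volOn hΩ
  obtain ⟨S, hS0, hS⟩ := exists_testFunction_poincare hΩ
  let W := (LinearMap.range (testGraph Ω)).topologicalClosure
  have : CompleteSpace W := (Submodule.isClosed_topologicalClosure _).completeSpace_coe
  let P : W →L[ℝ] Lp Plane 2 (volOn Ω) := (WithLp.sndL 2 ℝ _ _).comp W.subtypeL
  let B : W →L[ℝ] W →L[ℝ] ℝ := (innerSL ℝ).bilinearComp P P
  have hBapp : ∀ v w : W, B v w = inner ℝ (v : L2Pair Ω).snd (w : L2Pair Ω).snd := fun v w => rfl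
  have hB : IsCoercive B := by
    refine ⟨(S ^ 2 + 1)⁻¹, by positivity, fun w => ?_⟩
    rw [hBapp, real_inner_self_eq_norm_sq, mul_assoc, ← sq, inv_mul_le_iff₀ (by positivity)]
    -- The full norm is `‖z‖² + ‖∇z‖²`, and Poincaré bounds this by `(S² + 1)‖∇z‖²`, whence the
    -- coercivity constant.
    have h1 : ‖w‖ ^ 2 = ‖(w : L2Pair Ω).fst‖ ^ 2 + ‖(w : L2Pair Ω).snd‖ ^ 2 :=
      WithLp.prod_norm_sq_eq_of_L2 _
    have h2 := hS w w.2
    rw [h1]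
    have : ‖(w : L2Pair Ω).fst‖ ^ 2 ≤ (S * ‖(w : L2Pair Ω).snd‖) ^ 2 := by gcongr
    nlinarith
  let r : L2Pair Ω := WithLp.toLp 2 (hg.toLp g, -hf.toLp f)
  let ℓ : W →L[ℝ] ℝ := (innerSL ℝ r).comp W.subtypeL
  let v : W := hB.continuousLinearEquivOfBilin.symm ((InnerProductSpace.toDual ℝ W).symm ℓ)
  have hv : ∀ w : W, B v w = ℓ w := fun w => by
    rw [← hB.continuousLinearEquivOfBilin_apply, ContinuousLinearEquiv.apply_symm_apply,
      InnerProductSpace.toDual_symm_apply]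
  refine ⟨_, _, memW10_of_mem_closure v.2, fun φ => ?_⟩
  have hφ := hv ⟨testGraph Ω φ, subset_closure ⟨φ, rfl⟩⟩
  have hℓ : ℓ ⟨testGraph Ω φ, subset_closure ⟨φ, rfl⟩⟩ =
      inner ℝ (hg.toLp g) ((φ.memLp 2).toLp φ) +
      inner ℝ (-hf.toLp f) ((φ.memLp_gradient 2).toLp (gradient φ)) :=
    WithLp.prod_inner_apply _ _
  have hB' : B v ⟨testGraph Ω φ, subset_closure ⟨φ, rfl⟩⟩ =
      inner ℝ (v : L2Pair Ω).snd ((φ.memLp_gradient 2).toLp (gradient φ)) := rfl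
  rw [hℓ, hB', inner_neg_left, L2.inner_def, L2.inner_def, L2.inner_def, ← sub_eq_add_neg] at hφ
  convert hφ using 1
  · refine integral_congr_ae ?_
    filter_upwards [(φ.memLp_gradient 2).coeFn_toLp] with x hx
    rw [hx]
  · congr 1
    · refine integral_congr_ae ?_
      filter_upwards [(φ.memLp 2).coeFn_toLp, hg.coeFn_toLp] with x hx hx'
      rw [hx, hx']
      simp [mul_comm]
    · refine integral_congr_ae ?_
      filter_upwards [(φ.memLp_gradient 2).coeFn_toLp, hf.coeFn_toLp] with x hx hx'
      rw [hx, hx']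

/-! ### The dual problem: supremum bound and duality identity. -/

theorem IsDivSolution.weakDiv {f : Plane → Plane} {z : Plane → ℝ} {Z : Plane → Plane}
    (hz : IsDivSolution Ω f z Z) (hf : MemLp f 2 (volOn Ω)) :
    WeakDiv Ω (fun x => Z x + f x) 0 := by
  intro φ
  simp only [inner_add_left]
  rw [integral_add (integrable_inner_of_memLp hz.1.1.2.1 (φ.memLp_gradient 2))
    (integrable_inner_of_memLp hf (φ.memLp_gradient 2)), hz.2 φ]
  simp

theorem IsDivSolution.integral_inner {f : Plane → Plane} {z : Plane → ℝ} {Z : Plane → Plane}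
    (hz : IsDivSolution Ω f z Z) (hf : MemLp f 2 (volOn Ω)) {u : Plane → ℝ} {U : Plane → Plane}
    (hu : MemW10 Ω 2 u U) :
    ∫ x in (Ω : Set Plane), inner ℝ (f x) (U x) = -∫ x in (Ω : Set Plane), inner ℝ (Z x) (U x) := by
  have h := (hz.weakDiv hf).integral_inner (hz.1.1.2.1.add hf) MemLp.zero hu
  simp only [inner_add_left] at h
  rw [integral_add (integrable_inner_of_memLp hz.1.1.2.1 hu.1.2.1)
    (integrable_inner_of_memLp hf hu.1.2.1)] at h
  simp only [Pi.zero_apply, zero_mul, integral_zero] at h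
  linarith

/-- A function whose averages are bounded by `T` in absolute value is bounded by `T`. -/
theorem ae_abs_le_of_forall_abs_integral_mul_le {μ : Measure Plane} [IsFiniteMeasure μ]
    {z : Plane → ℝ} (hz : Integrable z μ) {T : ℝ}
    (h : ∀ g : Plane → ℝ, MemLp g 2 μ → eLpNorm g 1 μ ≤ 1 → |∫ x, g x * z x ∂μ| ≤ T) :
    ∀ᵐ x ∂μ, |z x| ≤ T := by
  have key : ∀ s : Set Plane, MeasurableSet s → |∫ x in s, z x ∂μ| ≤ μ.real s * T := by
    intro s hs
    rcases eq_or_ne (μ s) 0 with h0 | h0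
    · simp [Measure.restrict_eq_zero.2 h0, measureReal_def, h0]
    have hpos : 0 < μ.real s := ENNReal.toReal_pos h0 (measure_ne_top _ _)
    -- The test datum is the normalised indicator of `s`, of `L^1` norm one.
    have hg : MemLp (s.indicator fun _ => (μ.real s)⁻¹) 2 μ :=
      memLp_indicator_const 2 hs _ (.inr (measure_ne_top _ _))
    have := h _ hg ?_
    · have e : ∀ x, s.indicator (fun _ => (μ.real s)⁻¹) x * z x =
          s.indicator (fun x => (μ.real s)⁻¹ * z x) x := fun x => by
        by_cases hx : x ∈ s <;> simp [hx]
      simp only [e] at this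
      rw [integral_indicator hs, integral_const_mul, abs_mul, abs_of_pos (inv_pos.2 hpos),
        inv_mul_le_iff₀ hpos] at this
      exact this
    · rw [eLpNorm_indicator_const hs one_ne_zero ENNReal.one_ne_top, measureReal_def]
      rw [Real.enorm_of_nonneg (by positivity),
        ENNReal.ofReal_inv_of_pos (ENNReal.toReal_pos h0 (measure_ne_top _ _)),
        ENNReal.ofReal_toReal (measure_ne_top _ _)]
      simp [ENNReal.inv_mul_cancel h0 (measure_ne_top _ _)]
  have h1 : z ≤ᵐ[μ] fun _ => T := ae_le_of_forall_setIntegral_le hz (integrable_const _)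
    fun s hs _ => by
      rw [setIntegral_const, smul_eq_mul]
      exact (le_abs_self _).trans (key s hs)
  have h2 : (fun x => -z x) ≤ᵐ[μ] fun _ => T :=
    ae_le_of_forall_setIntegral_le hz.neg (integrable_const _) fun s hs _ => by
      rw [setIntegral_const, smul_eq_mul, integral_neg]
      exact (neg_le_abs _).trans (key s hs)
  filter_upwards [h1, h2] with x hx hx'
  exact abs_le'.2 ⟨hx, hx'⟩

/-- For `p > 2` the conjugate exponent falls in the range `q < 2` where the gradient estimate is
available. -/
theorem exists_holderConjugate_lt_two {p : ℝ≥0∞} (hp : 2 < p) :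
    ∃ q : ℝ≥0∞, 1 ≤ q ∧ q < 2 ∧ p.HolderConjugate q := by
  have hp' : p⁻¹ < 2⁻¹ := ENNReal.inv_lt_inv.2 hp
  have hp1 : p⁻¹ ≤ 1 := hp'.le.trans (by simp)
  refine ⟨(1 - p⁻¹)⁻¹, ENNReal.one_le_inv.2 tsub_le_self, ?_, ⟨?_⟩⟩
  · rw [← ENNReal.inv_lt_inv, inv_inv]
    refine lt_tsub_iff_right.2 ?_
    calc (2 : ℝ≥0∞)⁻¹ + p⁻¹ < 2⁻¹ + 2⁻¹ := ENNReal.add_lt_add_left (by simp) hp'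
      _ = 1 := ENNReal.inv_two_add_inv_two
  · rw [inv_inv, add_tsub_cancel_of_le hp1, inv_one]

/-- Supremum bound for `-Δz = div f` with `f ∈ L^p`, `p > 2`, by duality with the gradient
estimate. -/
theorem exists_ae_abs_le_of_isDivSolution (hΩ : Bornology.IsBounded (Ω : Set Plane)) {p : ℝ≥0∞}
    (hp : 2 < p) : ∃ K : ℝ≥0, ∀ f : Plane → Plane, MemLp f p (volOn Ω) →
      ∀ (z : Plane → ℝ) (Z : Plane → Plane), IsDivSolution Ω f z Z →
        ∀ᵐ x ∂(volOn Ω), |z x| ≤ (K * eLpNorm f p (volOn Ω)).toReal := by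
  have := isFiniteMeasure_volOn hΩ
  obtain ⟨q, hq1, hq2, hpq⟩ := exists_holderConjugate_lt_two hp
  obtain ⟨K, hK⟩ := exists_eLpNorm_gradient_le hΩ hq1 hq2 1
  refine ⟨K, fun f hf z Z hz => ?_⟩
  have hf2 : MemLp f 2 (volOn Ω) := hf.mono_exponent hp.le
  refine ae_abs_le_of_forall_abs_integral_mul_le (hz.1.1.1.integrable (by simp)) fun g hg hg1 => ?_
  -- The auxiliary problem `-Δu = g`. Testing it with `z`, and the equation of `z` with `u`, gives
  -- `∫ f·∇u = -∫ g z`.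
  obtain ⟨u, U, hu, hU⟩ := exists_weak_solution hΩ hg (MemLp.zero (ε := Plane))
  have hdiv : WeakDiv Ω U g := fun φ => by simpa using hU φ
  have e1 := hdiv.integral_inner hu.1.2.1 hg hz.1
  have e2 := hz.integral_inner hf2 hu
  have e3 : ∫ x in (Ω : Set Plane), inner ℝ (f x) (U x) = -∫ x in (Ω : Set Plane), g x * z x := by
    rw [e2, ← e1]; simp only [real_inner_comm]
  have hb := enorm_integral_inner_le (p := p) (q := q) hf.1 hu.1.2.1.1
  rw [e3, enorm_neg] at hb
  have hb2 := hb.trans (mul_le_mul_right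
    (hK u g U hu hdiv (hg.integrable (by simp)) (by simpa using hg1)) _)
  rw [mul_comm] at hb2
  have := ENNReal.toReal_mono (ENNReal.mul_ne_top ENNReal.coe_ne_top hf.2.ne) hb2
  simpa using this

/-- As `L` is only integrable, `z` must enter through a bounded smooth function. A truncation equal
to the identity on the range of `z` changes neither integral. -/
theorem IsDivSolution.integral_inner_eq_integral_mul {f : Plane → Plane} {z : Plane → ℝ}
    {Z : Plane → Plane} (hz : IsDivSolution Ω f z Z) (hf : MemLp f 2 (volOn Ω)) {T : ℝ}
    (hT : ∀ᵐ x ∂(volOn Ω), |z x| ≤ T) {u L : Plane → ℝ} {U : Plane → Plane}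
    (hu : MemW10 Ω 2 u U) (hdiv : WeakDiv Ω U (fun x => -L x)) (hL : Integrable L (volOn Ω)) :
    ∫ x in (Ω : Set Plane), inner ℝ (f x) (U x) = ∫ x in (Ω : Set Plane), z x * L x := by
  -- The extra unit in the radius makes `τ` the identity near each `t` with `|t| ≤ T`, so that also
  -- `τ'(t) = 1`.
  obtain ⟨τ, M, B, hτ, hτ1, -, hM, hB⟩ := exists_smooth_truncation (R := |T| + 1) (by positivity)
  have h := hdiv.integral_inner_comp hu.1.2.1 hL.neg hz.1 hτ (hτ1 0 (by simp; positivity)) hM hB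
  have hd : ∀ t, |t| ≤ T → deriv τ t = 1 := fun t ht => by
    have : τ =ᶠ[𝓝 t] id := by
      filter_upwards [Metric.ball_mem_nhds t one_pos] with s hs
      refine hτ1 s ?_
      rw [Metric.mem_ball, Real.dist_eq] at hs
      have := abs_sub_abs_le_abs_sub s t
      linarith [le_abs_self T]
    rw [this.deriv_eq, deriv_id]
  rw [hz.integral_inner hf hu]
  have e1 : ∫ x in (Ω : Set Plane), inner ℝ (U x) (deriv τ (z x) • Z x) =
      ∫ x in (Ω : Set Plane), inner ℝ (Z x) (U x) := by
    refine integral_congr_ae ?_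
    filter_upwards [hT] with x hx
    rw [hd _ hx, one_smul, real_inner_comm]
  have e2 : ∫ x in (Ω : Set Plane), -L x * τ (z x) = -∫ x in (Ω : Set Plane), z x * L x := by
    rw [← integral_neg]
    refine integral_congr_ae ?_
    filter_upwards [hT] with x hx
    rw [hτ1 _ (hx.trans (by linarith [le_abs_self T]))]
    ring
  rw [← e1, h, e2, neg_neg]

theorem dirichlet_gradient_bound (hΩ : Bornology.IsBounded (Ω : Set Plane)) (q : ℝ≥0∞)
    (hq1 : 1 ≤ q) (hq2 : q < 2) (C : ℝ≥0) : ∃ Cq : ℝ≥0,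
      ∀ (k : ℝ≥0∞) (ε : ℝ≥0), 1 ≤ k → 0 < ε → ε ≤ 1 →
      ∀ u L : Plane → ℝ, DirichletClass Ω k ε u → HasWeakLaplacian Ω u L →
        eLpNorm L 1 (volOn Ω) ≤ C → eLpNorm (gradient u) q (volOn Ω) ≤ Cq := by
  have := isFiniteMeasure_volOn hΩ
  obtain ⟨K, hK⟩ := exists_eLpNorm_gradient_le hΩ hq1 hq2 C
  refine ⟨K, fun k ε hk hε _ u L hu hL hC => ?_⟩
  have hW := hu.memW10 hΩ hε
  refine hK u (fun x => -L x) _ hW (hL.weakDiv hW.1.2.2) (hu.1.integrable_laplacian hk hL).neg ?_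
  rwa [← eLpNorm_neg] at hC

theorem dirichlet_duality (hΩ : Bornology.IsBounded (Ω : Set Plane)) (p : ℝ≥0∞) (hp : 2 < p) :
    ∃ K : ℝ≥0, ∀ f : Plane → Plane, MemLp f p (volOn Ω) →
        (∃ (z : Plane → ℝ) (Z : Plane → Plane), IsDivSolution Ω f z Z) ∧
        ∀ (z : Plane → ℝ) (Z : Plane → Plane), IsDivSolution Ω f z Z →
          eLpNorm z ∞ (volOn Ω) ≤ K * eLpNorm f p (volOn Ω) ∧
          ∀ (k : ℝ≥0∞) (ε : ℝ≥0), 1 ≤ k → 0 < ε → ε ≤ 1 →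
          ∀ u L : Plane → ℝ, DirichletClass Ω k ε u → HasWeakLaplacian Ω u L →
            ∫ x in (Ω : Set Plane), inner ℝ (f x) (gradient u x) =
              - ∫ x in (Ω : Set Plane), inner ℝ (Z x) (gradient u x) ∧
            ∫ x in (Ω : Set Plane), inner ℝ (f x) (gradient u x) =
              ∫ x in (Ω : Set Plane), z x * L x := by
  have := isFiniteMeasure_volOn hΩ
  obtain ⟨K, hK⟩ := exists_ae_abs_le_of_isDivSolution hΩ hp
  refine ⟨K, fun f hf => ?_⟩
  have hf2 : MemLp f 2 (volOn Ω) := hf.mono_exponent hp.le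
  refine ⟨?_, fun z Z hz => ?_⟩
  · obtain ⟨z, Z, hz, hZ⟩ := exists_weak_solution hΩ (MemLp.zero (ε := ℝ)) hf2
    exact ⟨z, Z, hz, fun φ => by simpa using hZ φ⟩
  have hb := hK f hf z Z hz
  refine ⟨?_, fun k ε hk hε _ u L hu hL => ?_⟩
  · rw [eLpNorm_exponent_top]
    refine (eLpNormEssSup_le_of_ae_bound hb).trans ?_
    exact ENNReal.ofReal_toReal_le
  · have hW := hu.memW10 hΩ hε
    exact ⟨hz.integral_inner hf2 hW, hz.integral_inner_eq_integral_mul hf2 hb hW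
      (hL.weakDiv hW.1.2.2) (hu.1.integrable_laplacian hk hL)⟩

/-! ### Rellich compactness. -/

theorem tendsto_fst_atTop : Tendsto (Prod.fst : ℕ × ℕ → ℕ) atTop atTop := by
  rw [← prod_atTop_atTop_eq]; exact tendsto_fst

theorem tendsto_snd_atTop : Tendsto (Prod.snd : ℕ × ℕ → ℕ) atTop atTop := by
  rw [← prod_atTop_atTop_eq]; exact tendsto_snd

/-- The fundamental theorem of calculus along the segment from `x` to `x - t`. -/
theorem TestFunction.enorm_sub_le (φ : 𝓓(Ω, ℝ)) (x t : Plane) :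
    ‖φ (x - t) - φ x‖ₑ ≤ ∫⁻ s in Icc (0 : ℝ) 1, ‖t‖ₑ * ‖gradient φ (x - s • t)‖ₑ := by
  have hd : ∀ s : ℝ, HasDerivAt (fun s : ℝ => φ (x - s • t))
      (inner ℝ (gradient φ (x - s • t)) (-t)) s := fun s => by
    have h1 : HasDerivAt (fun s : ℝ => x - s • t) (-t) s := by
      simpa using ((hasDerivAt_id s).smul_const t).const_sub x
    have := (φ.differentiable (x - s • t)).hasFDerivAt.comp_hasDerivAt s h1
    rwa [← inner_gradient_left] at this
  have hc : Continuous fun s : ℝ => inner ℝ (gradient φ (x - s • t)) (-t) :=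
    (φ.continuous_gradient.comp (by fun_prop)).inner continuous_const
  have h := intervalIntegral.integral_eq_sub_of_hasDerivAt (a := 0) (b := 1) (fun s _ => hd s)
    (hc.intervalIntegrable _ _)
  simp only [one_smul, zero_smul, sub_zero] at h
  rw [← h, intervalIntegral.integral_of_le zero_le_one, ← integral_Icc_eq_integral_Ioc]
  refine (enorm_integral_le_lintegral_enorm _).trans (lintegral_mono fun s => ?_)
  rw [mul_comm, ← enorm_neg t, ← ofReal_norm, ← ofReal_norm (gradient φ _), ← ofReal_norm (-t),
    ← ENNReal.ofReal_mul (norm_nonneg _)]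
  exact ENNReal.ofReal_le_ofReal (norm_inner_le_norm _ _)

/-- The `L^1` modulus of continuity of a test function is controlled by its gradient. -/
theorem TestFunction.lintegral_translate_sub_le (φ : 𝓓(Ω, ℝ)) (t : Plane) :
    ∫⁻ x, ‖φ (x - t) - φ x‖ₑ ≤ ‖t‖ₑ * ∫⁻ x, ‖gradient φ x‖ₑ := by
  have hc : Continuous fun z : Plane × ℝ => ‖t‖ₑ * ‖gradient φ (z.1 - z.2 • t)‖ₑ := by
    refine (ENNReal.continuous_const_mul enorm_ne_top).comp ?_
    exact (φ.continuous_gradient.comp (by fun_prop)).enorm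
  calc _ ≤ ∫⁻ x, ∫⁻ s in Icc (0 : ℝ) 1, ‖t‖ₑ * ‖gradient φ (x - s • t)‖ₑ :=
        lintegral_mono fun x => φ.enorm_sub_le x t
    _ = ∫⁻ s in Icc (0 : ℝ) 1, ∫⁻ x, ‖t‖ₑ * ‖gradient φ (x - s • t)‖ₑ :=
        lintegral_lintegral_swap hc.measurable.aemeasurable
    _ = ∫⁻ s in Icc (0 : ℝ) 1, ‖t‖ₑ * ∫⁻ x, ‖gradient φ x‖ₑ := by
        refine lintegral_congr fun s => ?_
        rw [lintegral_const_mul' _ _ enorm_ne_top,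
          lintegral_sub_right_eq_self (fun x => ‖gradient φ x‖ₑ)]
    _ = _ := by simp

/-- Mollification error in `L^1`. -/
theorem TestFunction.lintegral_convolution_sub_le (φ : 𝓓(Ω, ℝ)) (ρ : ContDiffBump (0 : Plane)) :
    ∫⁻ x, ‖MeasureTheory.convolution (ρ.normed volume) φ (ContinuousLinearMap.lsmul ℝ ℝ) volume x -
      φ x‖ₑ ≤ ENNReal.ofReal ρ.rOut * ∫⁻ x, ‖gradient φ x‖ₑ := by
  have hρ1 : ∫⁻ t, ‖ρ.normed volume t‖ₑ = 1 := by
    rw [← ofReal_integral_norm_eq_lintegral_enorm ρ.integrable_normed]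
    simp_rw [Real.norm_of_nonneg (ρ.nonneg_normed _)]
    rw [ρ.integral_normed, ENNReal.ofReal_one]
  have hc : Continuous fun z : Plane × Plane =>
      ‖ρ.normed volume z.2‖ₑ * ‖φ (z.1 - z.2) - φ z.1‖ₑ := by
    have h1 : Continuous fun z : Plane × Plane => ρ.normed volume z.2 * (φ (z.1 - z.2) - φ z.1) :=
      (ρ.continuous_normed.comp continuous_snd).mul
        ((φ.continuous.comp (by fun_prop)).sub (φ.continuous.comp (by fun_prop)))
    simpa only [enorm_mul] using h1.enorm
  have hpt : ∀ x, ‖MeasureTheory.convolution (ρ.normed volume) φ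
      (ContinuousLinearMap.lsmul ℝ ℝ) volume x - φ x‖ₑ ≤
      ∫⁻ t, ‖ρ.normed volume t‖ₑ * ‖φ (x - t) - φ x‖ₑ := fun x => by
    have e : MeasureTheory.convolution (ρ.normed volume) φ
        (ContinuousLinearMap.lsmul ℝ ℝ) volume x - φ x =
        ∫ t, ρ.normed volume t * (φ (x - t) - φ x) := by
      have i1 : Integrable (fun t => ρ.normed volume t * φ (x - t)) volume := by
        obtain ⟨M, hM⟩ := φ.exists_norm_le
        exact ρ.integrable_normed.mul_bdd
          (φ.continuous.comp (by fun_prop)).aestronglyMeasurable (.of_forall fun t => hM _)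
      simp only [mul_sub]
      rw [integral_sub i1 (ρ.integrable_normed.mul_const _), integral_mul_const,
        ρ.integral_normed, one_mul]
      rfl
    rw [e]
    refine (enorm_integral_le_lintegral_enorm _).trans_eq ?_
    simp only [enorm_mul]
  calc _ ≤ ∫⁻ x, ∫⁻ t, ‖ρ.normed volume t‖ₑ * ‖φ (x - t) - φ x‖ₑ := lintegral_mono hpt
    _ = ∫⁻ t, ∫⁻ x, ‖ρ.normed volume t‖ₑ * ‖φ (x - t) - φ x‖ₑ :=
        lintegral_lintegral_swap hc.measurable.aemeasurable
    _ ≤ ∫⁻ t, ‖ρ.normed volume t‖ₑ * (ENNReal.ofReal ρ.rOut * ∫⁻ x, ‖gradient φ x‖ₑ) := by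
        refine lintegral_mono fun t => ?_
        dsimp only
        rw [lintegral_const_mul' _ _ enorm_ne_top]
        by_cases ht : t ∈ Function.support (ρ.normed (volume : Measure Plane))
        · refine mul_le_mul_right ((φ.lintegral_translate_sub_le t).trans ?_) _
          gcongr
          rw [ρ.support_normed_eq, mem_ball_zero_iff] at ht
          rw [← ofReal_norm]
          exact ENNReal.ofReal_le_ofReal ht.le
        · simp [Function.notMem_support.1 ht]
    _ = _ := by
        rw [lintegral_mul_const _ ρ.continuous_normed.measurable.enorm, hρ1, one_mul]

/-- Weak sequential compactness of bounded sequences in `L²`. -/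
theorem exists_subseq_tendsto_inner {μ : Measure Plane} [IsFiniteMeasure μ]
    (f : ℕ → Lp ℝ 2 μ) {A : ℝ} (hf : ∀ n, ‖f n‖ ≤ A) :
    ∃ s : ℕ → ℕ, StrictMono s ∧ ∃ ℓ : Lp ℝ 2 μ → ℝ, ∀ h : Lp ℝ 2 μ,
      Tendsto (fun n => inner ℝ (f (s n)) h) atTop (𝓝 (ℓ h)) := by
  have : Fact ((2 : ℝ≥0∞) ≠ ∞) := ⟨by simp⟩
  obtain ⟨ℓ, -, s, hs, hlim⟩ := WeakDual.isSeqCompact_closedBall ℝ (Lp ℝ 2 μ)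
    (0 : StrongDual ℝ (Lp ℝ 2 μ)) A
    (x := fun n => StrongDual.toWeakDual (InnerProductSpace.toDual ℝ _ (f n)))
    (fun n => by simpa using hf n)
  refine ⟨s, hs, fun h => ℓ h, fun h => ?_⟩
  exact ((WeakDual.eval_continuous h).tendsto ℓ).comp hlim

/-- Rellich compactness: test functions bounded in `L²` with gradients bounded in `L¹` have a
subsequence which is Cauchy in `L¹`. -/
theorem exists_subseq_cauchy (hΩ : Bornology.IsBounded (Ω : Set Plane)) (φ : ℕ → 𝓓(Ω, ℝ))
    {A B : ℝ≥0} (hA : ∀ n, eLpNorm (φ n) 2 (volOn Ω) ≤ A)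
    (hB : ∀ n, eLpNorm (gradient (φ n)) 1 (volOn Ω) ≤ B) :
    ∃ s : ℕ → ℕ, StrictMono s ∧ Tendsto (fun n : ℕ × ℕ =>
      eLpNorm (fun x => φ (s n.1) x - φ (s n.2) x) 1 (volOn Ω)) atTop (𝓝 0) := by
  have := isFiniteMeasure_volOn hΩ
  have hAn : ∀ n, ‖((φ n).memLp 2).toLp (φ n)‖ ≤ A := fun n => by
    rw [Lp.norm_toLp]; exact ENNReal.toReal_le_coe_of_le_coe (hA n)
  -- The subsequence comes from weak `L²` convergence alone, before a mollification scale is fixed,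
  -- so it serves every `ε`.
  obtain ⟨s, hs, ℓ, hℓ⟩ := exists_subseq_tendsto_inner _ hAn
  refine ⟨s, hs, ?_⟩
  have hgrad : ∀ n, ∫⁻ x, ‖gradient (φ n) x‖ₑ ≤ B := fun n => by
    rw [← eLpNorm_one_eq_lintegral_enorm, ← eLpNorm_restrict_eq_of_support_subset (s := Ω)]
    · exact hB n
    · intro x hx; by_contra h; exact hx ((φ n).gradient_eq_zero h)
  rw [ENNReal.tendsto_nhds_zero]
  intro ε hε
  obtain ⟨δ, hδ0, hδ⟩ : ∃ δ : ℝ, 0 < δ ∧ ENNReal.ofReal δ * B ≤ ε / 3 := by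
    have h3 : 0 < ε / 3 := ENNReal.div_pos hε.ne' (by simp)
    have ht : Tendsto (fun δ : ℝ => ENNReal.ofReal δ * B) (𝓝[>] 0) (𝓝 0) := by
      have : Tendsto (fun δ : ℝ => ENNReal.ofReal δ) (𝓝[>] 0) (𝓝 0) := by
        simpa using (ENNReal.continuous_ofReal.tendsto 0).mono_left nhdsWithin_le_nhds
      simpa using ENNReal.Tendsto.mul_const this (.inr ENNReal.coe_ne_top) (b := (B : ℝ≥0∞))
    obtain ⟨δ, h1, h2⟩ := ((ht.eventually (ge_mem_nhds h3)).and self_mem_nhdsWithin).exists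
    exact ⟨δ, h2, h1⟩
  let ρ : ContDiffBump (0 : Plane) := ⟨δ / 2, δ, half_pos hδ0, half_lt_self hδ0⟩
  obtain ⟨M, hM⟩ := ρ.hasCompactSupport_normed.exists_bound_of_continuous
    (ρ.continuous_normed (μ := volume))
  let T : ℕ → Plane → ℝ := fun n => MeasureTheory.convolution (ρ.normed volume) (φ n)
    (ContinuousLinearMap.lsmul ℝ ℝ) volume
  have hTc : ∀ n, Continuous (T n) := fun n =>
    (ρ.hasCompactSupport_normed.contDiff_convolution_left (n := 0) _ ρ.contDiff_normed
      (φ n).continuous.locallyIntegrable).continuous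
  have hh : ∀ x : Plane, MemLp (fun y => ρ.normed volume (x - y)) 2 (volOn Ω) := fun x =>
    .of_bound (ρ.continuous_normed.comp (by fun_prop)).aestronglyMeasurable M
      (.of_forall fun y => hM _)
  -- At a fixed scale, mollification at `x` is the `L²` pairing with a fixed kernel; weak
  -- convergence thus becomes pointwise convergence, with a bound uniform in `n` and `x`.
  have hTinner : ∀ n x, T n x = inner ℝ (((φ n).memLp 2).toLp (φ n)) ((hh x).toLp _) := by
    intro n x
    rw [L2.inner_def]
    have : T n x = ∫ y in (Ω : Set Plane), ρ.normed volume (x - y) * φ n y := by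
      rw [setIntegral_eq_integral_of_forall_compl_eq_zero]
      · exact convolution_eq_swap _
      · intro y hy; simp [(φ n).apply_eq_zero hy]
    rw [this]
    refine integral_congr_ae ?_
    filter_upwards [((φ n).memLp 2).coeFn_toLp, (hh x).coeFn_toLp] with y h1 h2
    rw [h1, h2]
    simp
  have hTb : ∀ n, ∀ x, ‖T n x‖ ≤ A * (M * (volOn Ω).real univ ^ (1 / 2 : ℝ)) := fun n x => by
    rw [hTinner]
    refine (norm_inner_le_norm _ _).trans (mul_le_mul (hAn n) ?_ (norm_nonneg _) A.2)
    rw [Lp.norm_toLp]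
    have h := eLpNorm_le_of_ae_bound (p := 2) (μ := volOn Ω)
      (f := fun y => ρ.normed volume (x - y)) (.of_forall fun y => hM _)
    have hM0 : 0 ≤ M := (norm_nonneg _).trans (hM 0)
    refine (ENNReal.toReal_mono (ENNReal.mul_ne_top (ENNReal.rpow_ne_top_of_nonneg (by positivity)
      (measure_ne_top _ _)) ENNReal.ofReal_ne_top) h).trans_eq ?_
    rw [ENNReal.toReal_mul, ENNReal.toReal_ofReal hM0, ← ENNReal.toReal_rpow, measureReal_def,
      mul_comm]
    norm_num
  let g : Plane → ℝ := fun x => ℓ ((hh x).toLp _)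
  have hTg : ∀ x, Tendsto (fun n => T (s n) x) atTop (𝓝 (g x)) := fun x => by
    simp only [hTinner]; exact hℓ _
  have hgm : AEStronglyMeasurable g (volOn Ω) :=
    aestronglyMeasurable_of_tendsto_ae atTop (fun n => (hTc (s n)).aestronglyMeasurable)
      (.of_forall hTg)
  have hgb : ∀ x, ‖g x‖ ≤ A * (M * (volOn Ω).real univ ^ (1 / 2 : ℝ)) := fun x =>
    le_of_tendsto (hTg x).norm (.of_forall fun n => hTb _ x)
  have hconv : Tendsto (fun n => eLpNorm (fun x => T (s n) x - g x) 1 (volOn Ω)) atTop (𝓝 0) := by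
    refine tendsto_eLpNorm_of_dominated one_ne_zero ENNReal.one_ne_top
      (b := fun _ => 2 * (A * (M * (volOn Ω).real univ ^ (1 / 2 : ℝ))))
      (fun n => (hTc (s n)).aestronglyMeasurable.sub hgm) (memLp_const _)
      (fun n => .of_forall fun x => ?_) (.of_forall fun x => by simpa using (hTg x).sub_const (g x))
    exact (norm_sub_le _ _).trans (by linarith [hTb (s n) x, hgb x])
  have herr : ∀ n, eLpNorm (fun x => T n x - φ n x) 1 (volOn Ω) ≤ ε / 3 := fun n => by
    rw [eLpNorm_one_eq_lintegral_enorm]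
    refine (setLIntegral_le_lintegral _ _).trans
      (((φ n).lintegral_convolution_sub_le ρ).trans (le_trans ?_ hδ))
    exact mul_le_mul_right (hgrad n) _
  have h2 : Tendsto (fun n : ℕ × ℕ => eLpNorm (fun x => T (s n.1) x - g x) 1 (volOn Ω) +
      eLpNorm (fun x => T (s n.2) x - g x) 1 (volOn Ω)) atTop (𝓝 0) := by
    have := (hconv.comp tendsto_fst_atTop).add (hconv.comp tendsto_snd_atTop)
    simpa [Function.comp_def] using this
  have h3 : 0 < ε / 3 := ENNReal.div_pos hε.ne' (by simp)
  filter_upwards [h2.eventually (ge_mem_nhds h3)] with n hn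
  have hm : ∀ k, AEStronglyMeasurable (fun x => T k x - φ k x) (volOn Ω) := fun k =>
    ((hTc k).sub (φ k).continuous).aestronglyMeasurable
  have hm' : ∀ k, AEStronglyMeasurable (fun x => T k x - g x) (volOn Ω) := fun k =>
    (hTc k).aestronglyMeasurable.sub hgm
  calc eLpNorm (fun x => φ (s n.1) x - φ (s n.2) x) 1 (volOn Ω)
      ≤ eLpNorm ((fun x => T (s n.1) x - g x) - fun x => T (s n.2) x - g x) 1 (volOn Ω) +
        eLpNorm ((fun x => T (s n.1) x - φ (s n.1) x) - fun x => T (s n.2) x - φ (s n.2) x) 1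
          (volOn Ω) := by
        refine (eLpNorm_congr_ae (.of_forall fun x => ?_)).trans_le (eLpNorm_sub_le
          ((hm' _).sub (hm' _)) ((hm _).sub (hm _)) le_rfl)
        simp only [Pi.sub_apply]; ring
    _ ≤ (eLpNorm (fun x => T (s n.1) x - g x) 1 (volOn Ω) +
          eLpNorm (fun x => T (s n.2) x - g x) 1 (volOn Ω)) +
        (eLpNorm (fun x => T (s n.1) x - φ (s n.1) x) 1 (volOn Ω) +
          eLpNorm (fun x => T (s n.2) x - φ (s n.2) x) 1 (volOn Ω)) := by
        gcongr
        · exact eLpNorm_sub_le (hm' _) (hm' _) le_rfl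
        · exact eLpNorm_sub_le (hm _) (hm _) le_rfl
    _ ≤ ε / 3 + (ε / 3 + ε / 3) := by gcongr <;> exact herr _
    _ = ε := by rw [← add_assoc, ENNReal.add_thirds]

/-! ### Interpolation and limits in `L^p`. -/

section Interpolation

variable {α E : Type*} [MeasurableSpace α] {μ : Measure α} [NormedAddCommGroup E]

/-- Interpolation between `L^1` and `L^r`. -/
theorem eLpNorm_rpow_le_interpolation {F : α → E} (hF : AEStronglyMeasurable F μ) {q r : ℝ≥0∞}
    (hq : 1 ≤ q) (hqr : q < r) (hr : r ≠ ∞) :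
    eLpNorm F q μ ^ q.toReal ≤
      eLpNorm F 1 μ ^ ((r.toReal - q.toReal) / (r.toReal - 1)) *
        (eLpNorm F r μ ^ r.toReal) ^ ((q.toReal - 1) / (r.toReal - 1)) := by
  have hq' : q ≠ ∞ := hqr.ne_top
  have h1 : 1 ≤ q.toReal := by simpa using ENNReal.toReal_mono hq' hq
  have h2 : q.toReal < r.toReal := (ENNReal.toReal_lt_toReal hq' hr).2 hqr
  have hr0 : r ≠ 0 := (zero_le.trans_lt hqr).ne'
  have hq0 : q ≠ 0 := (zero_lt_one.trans_le hq).ne'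
  have key : ∀ {p : ℝ≥0∞}, p ≠ 0 → p ≠ ∞ →
      eLpNorm F p μ ^ p.toReal = ∫⁻ x, ‖F x‖ₑ ^ p.toReal ∂μ := fun h0 ht => by
    rw [eLpNorm_eq_lintegral_rpow_enorm_toReal h0 ht, ← ENNReal.rpow_mul, one_div,
      inv_mul_cancel₀ (ENNReal.toReal_pos h0 ht).ne', ENNReal.rpow_one]
  rw [key hq0 hq', key hr0 hr, eLpNorm_one_eq_lintegral_enorm]
  have hd : 0 < r.toReal - 1 := by linarith
  have hs : 0 ≤ (r.toReal - q.toReal) / (r.toReal - 1) := div_nonneg (by linarith) hd.le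
  have ht : 0 ≤ (q.toReal - 1) / (r.toReal - 1) := div_nonneg (by linarith) hd.le
  -- The two weights add up to 1 and write `q` as the corresponding convex combination of `1` and
  -- `r`.
  refine le_trans (le_of_eq ?_) (ENNReal.lintegral_mul_norm_pow_le hF.enorm
    (hF.enorm.pow_const r.toReal) hs ht (by field_simp; ring))
  refine lintegral_congr fun x => ?_
  rw [← ENNReal.rpow_mul, ← ENNReal.rpow_add_of_nonneg _ _ hs (by positivity)]
  congr 1
  field_simp
  ring

theorem tendsto_eLpNorm_of_interpolation {ι : Type*} {l : Filter ι} {F : ι → α → E}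
    (hF : ∀ i, AEStronglyMeasurable (F i) μ) {q r : ℝ≥0∞} (hq : 1 ≤ q) (hqr : q < r) (hr : r ≠ ∞)
    {K : ℝ≥0∞} (hK' : K ≠ ∞) (hK : ∀ i, eLpNorm (F i) r μ ≤ K)
    (h : Tendsto (fun i => eLpNorm (F i) 1 μ) l (𝓝 0)) :
    Tendsto (fun i => eLpNorm (F i) q μ) l (𝓝 0) := by
  have hq' : q ≠ ∞ := hqr.ne_top
  have h1 : 1 ≤ q.toReal := by simpa using ENNReal.toReal_mono hq' hq
  have h2 : q.toReal < r.toReal := (ENNReal.toReal_lt_toReal hq' hr).2 hqr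
  have hs : 0 < (r.toReal - q.toReal) / (r.toReal - 1) := div_pos (by linarith) (by linarith)
  have ht : 0 ≤ (q.toReal - 1) / (r.toReal - 1) := div_nonneg (by linarith) (by linarith)
  have hc : (K ^ r.toReal) ^ ((q.toReal - 1) / (r.toReal - 1)) ≠ ∞ :=
    ENNReal.rpow_ne_top_of_nonneg ht (ENNReal.rpow_ne_top_of_nonneg (by positivity) hK')
  have h3 := ENNReal.Tendsto.mul_const (h.ennrpow_const ((r.toReal - q.toReal) / (r.toReal - 1)))
    (.inr hc)
  rw [ENNReal.zero_rpow_of_pos hs, zero_mul] at h3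
  have h4 := (tendsto_of_tendsto_of_tendsto_of_le_of_le tendsto_const_nhds h3 (fun _ => zero_le)
    fun i => (eLpNorm_rpow_le_interpolation (hF i) hq hqr hr).trans (by
      gcongr; exact hK i)).ennrpow_const q.toReal⁻¹
  rw [ENNReal.zero_rpow_of_pos (by positivity)] at h4
  refine h4.congr fun i => ?_
  rw [← ENNReal.rpow_mul, mul_inv_cancel₀ (by positivity), ENNReal.rpow_one]

theorem exists_tendsto_eLpNorm_of_cauchy [CompleteSpace E] {f : ℕ → α → E}
    (hf : ∀ n, MemLp (f n) 1 μ)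
    (h : Tendsto (fun n : ℕ × ℕ => eLpNorm (fun x => f n.1 x - f n.2 x) 1 μ) atTop (𝓝 0)) :
    ∃ g : α → E, MemLp g 1 μ ∧
      Tendsto (fun n => eLpNorm (fun x => f n x - g x) 1 μ) atTop (𝓝 0) := by
  have hc : CauchySeq fun n => (hf n).toLp (f n) := by
    rw [Lp.cauchySeq_Lp_iff_cauchySeq_eLpNorm]
    refine h.congr fun n => eLpNorm_congr_ae ?_
    filter_upwards [(hf n.1).coeFn_toLp, (hf n.2).coeFn_toLp] with x h1 h2
    simp [h1, h2]
  obtain ⟨g, hg⟩ := cauchySeq_tendsto_of_complete hc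
  refine ⟨g, Lp.memLp g, ((Lp.tendsto_Lp_iff_tendsto_eLpNorm' _ _).1 hg).congr fun n =>
    eLpNorm_congr_ae ?_⟩
  filter_upwards [(hf n).coeFn_toLp] with x h1
  simp [h1]

/-- Lower semicontinuity of the `L^r` norm under `L^p` convergence. -/
theorem eLpNorm_le_of_tendsto_eLpNorm {p r : ℝ≥0∞} (hp : p ≠ 0) {f : ℕ → α → E} {g : α → E}
    (hf : ∀ n, AEStronglyMeasurable (f n) μ) (hg : AEStronglyMeasurable g μ)
    (h : Tendsto (fun n => eLpNorm (fun x => f n x - g x) p μ) atTop (𝓝 0)) {K : ℝ≥0∞}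
    (hK : ∀ n, eLpNorm (f n) r μ ≤ K) : eLpNorm g r μ ≤ K := by
  obtain ⟨s, -, hae⟩ := (tendstoInMeasure_of_tendsto_eLpNorm hp hf hg h).exists_seq_tendsto_ae
  exact Lp.eLpNorm_le_of_ae_tendsto (.of_forall fun n => hK (s n)) (fun n => hf (s n)) hae

theorem exists_eLpNorm_le_of_exponent_le [IsFiniteMeasure μ] {q p : ℝ≥0∞} (hq : 1 ≤ q)
    (hqp : q ≤ p) : ∃ c : ℝ≥0∞, c ≠ ∞ ∧ ∀ f : α → E, AEStronglyMeasurable f μ →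
      eLpNorm f q μ ≤ c * eLpNorm f p μ := by
  refine ⟨μ univ ^ (1 / q.toReal - 1 / p.toReal), ENNReal.rpow_ne_top_of_nonneg ?_
    (measure_ne_top _ _), fun f hf => ?_⟩
  · rcases eq_or_ne p ∞ with rfl | hp
    · simp
    · have h0 : q ≠ ∞ := ne_top_of_le_ne_top hp hqp
      have h1 : 1 ≤ q.toReal := by simpa using ENNReal.toReal_mono h0 hq
      exact sub_nonneg.2 (one_div_le_one_div_of_le (by linarith) (ENNReal.toReal_mono hp hqp))
  · rw [mul_comm]; exact eLpNorm_le_eLpNorm_mul_rpow_measure_univ hqp hf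

end Interpolation

/-! ### Smallness of gradients from smallness of functions. -/

/-- The gradient is controlled in `L^1` by the size of the function when the datum is `L^1`. -/
theorem WeakDiv.sq_eLpNorm_one_le {g w : Plane → ℝ} {W : Plane → Plane} (h : WeakDiv Ω W g)
    (hg : Integrable g (volOn Ω)) (hw : MemW10 Ω 2 w W) {δ : ℝ≥0} (hδ : 0 < δ)
    (hle : eLpNorm w 2 (volOn Ω) ≤ δ) :
    eLpNorm W 1 (volOn Ω) ^ 2 ≤
      (volOn Ω univ + 1) *
        (δ * (ENNReal.ofReal (Real.pi / 2) * eLpNorm g 1 (volOn Ω))) := by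
  have hδ' : (0 : ℝ) < δ := hδ
  let ψ : ℝ → ℝ := fun t => Real.arctan (t / δ)
  let χ : ℝ → ℝ := fun t => (√(1 + (t / δ) ^ 2))⁻¹
  have hpos : ∀ t : ℝ, 0 < 1 + (t / δ) ^ 2 := fun t => by positivity
  have hder : ∀ t, deriv ψ t = 1 / (1 + (t / δ) ^ 2) * (1 / δ) := fun t =>
    ((hasDerivAt_id t).div_const (δ : ℝ)).arctan.deriv
  -- With `ψ(t) = arctan(t/δ)` one has `χ² = δψ'`; the factor `c = δ` is the gain.
  have key := h.sq_eLpNorm_le hg hw (ψ := ψ) (χ := χ) (c := δ) (M := 1 / δ) (B := Real.pi / 2)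
    (Real.contDiff_arctan.comp (contDiff_id.div_const _)) (by simp [ψ]) (fun t => ?_) (fun t => ?_)
    hδ'.le (fun t => ?_)
  rotate_left
  · rw [hder, abs_of_nonneg (by positivity)]
    have : 1 / (1 + (t / δ) ^ 2) ≤ 1 := by
      rw [div_le_one (hpos t)]; nlinarith [sq_nonneg (t / (δ : ℝ))]
    exact mul_le_of_le_one_left (by positivity) this
  · exact abs_le.2 ⟨(Real.neg_pi_div_two_lt_arctan _).le, (Real.arctan_lt_pi_div_two _).le⟩
  · rw [hder, inv_pow, Real.sq_sqrt (hpos t).le]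
    apply le_of_eq; field_simp
  have hc : Continuous fun t : ℝ => √(1 + (t / δ) ^ 2) := by fun_prop
  have hχc : Continuous χ := hc.inv₀ fun t => (Real.sqrt_pos.2 (hpos t)).ne'
  -- Hölder's inequality for `W = √(1+(w/δ)²) · χ(w)W`; the first factor has squared `L²` norm at
  -- most `|Ω| + 1` because `‖w‖_2 ≤ δ`.
  have hold := eLpNorm_smul_le_mul_eLpNorm (p := 2) (q := 2) (r := 1)
    ((hχc.comp_aestronglyMeasurable hw.1.1.1).smul hw.1.2.1.1)
    (hc.comp_aestronglyMeasurable hw.1.1.1)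
  have hW : (fun x => √(1 + (w x / δ) ^ 2)) • (fun x => χ (w x)) • W = W := by
    ext1 x
    simp only [Pi.smul_apply', χ, smul_smul]
    rw [mul_inv_cancel₀ (Real.sqrt_pos.2 (hpos _)).ne', one_smul]
  have h1 : eLpNorm (fun x => √(1 + (w x / δ) ^ 2)) 2 (volOn Ω) ^ 2 ≤
      volOn Ω univ + 1 := by
    rw [sq_eLpNorm_two]
    have e : ∀ x, ‖√(1 + (w x / δ) ^ 2)‖ₑ ^ 2 =
        1 + (δ : ℝ≥0∞)⁻¹ ^ 2 * ‖w x‖ₑ ^ 2 := fun x => by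
      rw [Real.enorm_of_nonneg (Real.sqrt_nonneg _),
        ← ENNReal.ofReal_pow (Real.sqrt_nonneg _), Real.sq_sqrt (hpos _).le,
        ENNReal.ofReal_add zero_le_one (by positivity), ENNReal.ofReal_one, ← sq_abs (w x / δ),
        ENNReal.ofReal_pow (abs_nonneg _), abs_div, abs_of_pos hδ',
        ENNReal.ofReal_div_of_pos hδ', ENNReal.ofReal_coe_nnreal, ← Real.enorm_eq_ofReal_abs,
        ENNReal.div_eq_inv_mul, mul_pow]
    rw [lintegral_congr e, lintegral_add_left measurable_const, lintegral_const, one_mul,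
      lintegral_const_mul' _ _ (by simp [hδ.ne']), ← sq_eLpNorm_two, ← mul_pow]
    gcongr
    refine pow_le_one₀ zero_le ((mul_le_mul_right hle _).trans_eq ?_)
    exact ENNReal.inv_mul_cancel (by simpa using hδ.ne') ENNReal.coe_ne_top
  rw [hW] at hold
  calc _ ≤ _ := pow_le_pow_left₀ zero_le hold 2
    _ ≤ _ := by
      rw [mul_pow]
      refine mul_le_mul' h1 (key.trans_eq ?_)
      rw [ENNReal.ofReal_mul hδ'.le, ENNReal.ofReal_coe_nnreal, mul_assoc]

/-- The filter is arbitrary so that the statement applies to differences indexed by pairs and yields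
a Cauchy property. -/
theorem tendsto_eLpNorm_one_of_weakDiv [IsFiniteMeasure (volOn Ω)] {ι : Type*} {l : Filter ι}
    {g w : ι → Plane → ℝ} {W : ι → Plane → Plane} (h : ∀ i, WeakDiv Ω (W i) (g i))
    (hg : ∀ i, Integrable (g i) (volOn Ω)) (hw : ∀ i, MemW10 Ω 2 (w i) (W i)) {D : ℝ≥0}
    (hD : ∀ i, eLpNorm (g i) 1 (volOn Ω) ≤ D)
    (hlim : Tendsto (fun i => eLpNorm (w i) 2 (volOn Ω)) l (𝓝 0)) :
    Tendsto (fun i => eLpNorm (W i) 1 (volOn Ω)) l (𝓝 0) := by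
  rw [ENNReal.tendsto_nhds_zero]
  intro ε hε
  obtain ⟨δ, hδ, hδε⟩ := ENNReal.exists_nnreal_pos_mul_lt
    (a := (volOn Ω univ + 1) * (ENNReal.ofReal (Real.pi / 2) * D)) (b := ε ^ 2)
    (ENNReal.mul_ne_top (ENNReal.add_ne_top.2 ⟨measure_ne_top _ _, ENNReal.one_ne_top⟩)
      (by finiteness)) (by positivity)
  filter_upwards [hlim.eventually (ge_mem_nhds (ENNReal.coe_pos.2 hδ))] with i hi
  refine (ENNReal.pow_le_pow_left_iff two_ne_zero).1
    (((h i).sq_eLpNorm_one_le (hg i) (hw i) hδ hi).trans (le_trans ?_ hδε.le))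
  rw [mul_left_comm]
  gcongr
  exact hD i

/-! ### Brezis-Merle solutions and passage from local to global convergence. -/

theorem IsBrezisMerleSolution.weakDiv (hΩ : Bornology.IsBounded (Ω : Set Plane)) {k : ℝ≥0∞}
    {ε b C : ℝ≥0} (hε : 0 < ε) {V u : Plane → ℝ}
    (h : IsBrezisMerleSolution Ω k ε b C V u) :
    WeakDiv Ω (gradient u) (fun x => V x * Real.exp (u x)) := by
  have := (h.2.2.2.1).weakDiv (h.1.memW10 hΩ hε).1.2.2
  simpa using this

theorem IsBrezisMerleSolution.integrable (hΩ : Bornology.IsBounded (Ω : Set Plane)) {k : ℝ≥0∞}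
    {ε b C : ℝ≥0} (hk : 1 ≤ k) {V u : Plane → ℝ}
    (h : IsBrezisMerleSolution Ω k ε b C V u) :
    Integrable (fun x => V x * Real.exp (u x)) (volOn Ω) := by
  have := isFiniteMeasure_volOn hΩ
  simpa using (h.1.1.integrable_laplacian hk h.2.2.2.1).neg

theorem IsBrezisMerleSolution.eLpNorm_le {k : ℝ≥0∞} {ε b C : ℝ≥0} {V u : Plane → ℝ}
    (h : IsBrezisMerleSolution Ω k ε b C V u) :
    eLpNorm (fun x => V x * Real.exp (u x)) 1 (volOn Ω) ≤ (b * C : ℝ≥0) := by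
  rw [eLpNorm_one_eq_lintegral_enorm, ENNReal.coe_mul]
  refine (lintegral_mono_ae (g := fun x => (b : ℝ≥0∞) * ENNReal.ofReal (Real.exp (u x))) ?_).trans ?_
  · filter_upwards [h.2.2.1] with x hx
    rw [enorm_mul, Real.enorm_of_nonneg hx.1, Real.enorm_of_nonneg (Real.exp_nonneg _)]
    gcongr
    exact (ENNReal.ofReal_le_ofReal hx.2).trans_eq ENNReal.ofReal_coe_nnreal
  · rw [lintegral_const_mul' _ _ ENNReal.coe_ne_top]
    gcongr
    exact h.2.2.2.2

theorem IsBrezisMerleSolution.exists_eLpNorm_gradient_le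
    (hΩ : Bornology.IsBounded (Ω : Set Plane)) {q : ℝ≥0∞} (hq1 : 1 ≤ q) (hq2 : q < 2)
    {k : ℝ≥0∞} {ε : ℝ≥0} (hk : 1 ≤ k) (hε : 0 < ε) (b C : ℝ≥0) :
    ∃ K : ℝ≥0, ∀ V u : Plane → ℝ, IsBrezisMerleSolution Ω k ε b C V u →
      eLpNorm (gradient u) q (volOn Ω) ≤ K := by
  obtain ⟨K, hK⟩ := _root_.exists_eLpNorm_gradient_le hΩ hq1 hq2 (b * C)
  exact ⟨K, fun V u h => hK u _ _ (h.1.memW10 hΩ hε) (h.weakDiv hΩ hε) (h.integrable hΩ hk)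
    h.eLpNorm_le⟩

/-- Local convergence and a bound in a better space give global convergence. -/
theorem tendsto_eLpNorm_of_forall_isCompact (hΩ : Bornology.IsBounded (Ω : Set Plane))
    {U : ℕ → Plane → Plane} {G : Plane → Plane}
    (hU : ∀ i, AEStronglyMeasurable (U i) (volOn Ω)) (hG : AEStronglyMeasurable G (volOn Ω))
    {q r : ℝ≥0∞} (hq : 1 ≤ q) (hqr : q < r) (hr : r ≠ ∞) {K : ℝ≥0}
    (hK : ∀ i, eLpNorm (U i) r (volOn Ω) ≤ K)
    (h : ∀ S : Set Plane, IsCompact S → S ⊆ Ω →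
      Tendsto (fun i => eLpNorm (fun x => U i x - G x) q (volume.restrict S)) atTop (𝓝 0)) :
    Tendsto (fun i => eLpNorm (fun x => U i x - G x) q (volOn Ω)) atTop (𝓝 0) := by
  have := isFiniteMeasure_volOn hΩ
  obtain ⟨F, hFc, hFsub, hFU, hFm⟩ := Ω.isOpen.exists_iUnion_isClosed
  have hFcomp : ∀ n, IsCompact (F n) := fun n =>
    Metric.isCompact_of_isClosed_isBounded (hFc n) (hΩ.subset (hFsub n))
  have hres : ∀ n, (volOn Ω).restrict (F n) = volume.restrict (F n) := fun n => by
    rw [Measure.restrict_restrict (hFc n).measurableSet, inter_eq_left.2 (hFsub n)]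
  have hle : ∀ n, volume.restrict (F n) ≤ volOn Ω := fun n =>
    Measure.restrict_mono_set _ (hFsub n)
  -- The limit inherits the `L^r` bound on each compact `F n` by lower semicontinuity, and then on
  -- `Ω` by exhaustion.
  have hGK : eLpNorm G r (volOn Ω) ≤ K := by
    refine Lp.eLpNorm_le_of_ae_tendsto (u := atTop) (f := fun n => (F n).indicator G)
      (.of_forall fun n => ?_) (fun n => hG.indicator (hFc n).measurableSet) ?_
    · rw [eLpNorm_indicator_eq_eLpNorm_restrict (hFc n).measurableSet, hres]
      exact eLpNorm_le_of_tendsto_eLpNorm (zero_lt_one.trans_le hq).ne'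
        (fun i => (hU i).mono_measure (hle n)) (hG.mono_measure (hle n)) (h _ (hFcomp n) (hFsub n))
        fun i => (eLpNorm_mono_measure _ (hle n)).trans (hK i)
    · filter_upwards [ae_restrict_mem Ω.isOpen.measurableSet] with x hx
      obtain ⟨n, hn⟩ := mem_iUnion.1 (hFU.symm ▸ hx : x ∈ ⋃ n, F n)
      refine tendsto_const_nhds.congr' ?_
      filter_upwards [eventually_ge_atTop n] with m hm
      exact (indicator_of_mem (hFm hm hn) G).symm
  have hq' : q ≠ ∞ := hqr.ne_top
  have hq0 : 0 < q.toReal := ENNReal.toReal_pos (zero_lt_one.trans_le hq).ne' hq'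
  have he : 0 < 1 / q.toReal - 1 / r.toReal :=
    sub_pos.2 (one_div_lt_one_div_of_lt hq0 ((ENNReal.toReal_lt_toReal hq' hr).2 hqr))
  have hD : ∀ i, AEStronglyMeasurable (fun x => U i x - G x) (volOn Ω) := fun i => (hU i).sub hG
  have hDK : ∀ i, eLpNorm (fun x => U i x - G x) r (volOn Ω) ≤ K + K := fun i =>
    (eLpNorm_sub_le (hU i) hG (hq.trans hqr.le)).trans (add_le_add (hK i) hGK)
  have hm : Tendsto (fun n => volOn Ω (F n)ᶜ) atTop (𝓝 0) := by
    have := tendsto_measure_iInter_atTop (μ := volOn Ω) (s := fun n => (F n)ᶜ)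
      (fun n => (hFc n).measurableSet.compl.nullMeasurableSet)
      (fun m n hmn => compl_subset_compl.2 (hFm hmn)) ⟨0, measure_ne_top _ _⟩
    rwa [← compl_iUnion, hFU, Measure.restrict_apply Ω.isOpen.measurableSet.compl,
      compl_inter_self, measure_empty] at this
  have hm' : Tendsto (fun n => (K + K : ℝ≥0∞) * volOn Ω (F n)ᶜ ^ (1 / q.toReal - 1 / r.toReal))
      atTop (𝓝 0) := by
    refine tendsto_const_mul_zero (by finiteness) ?_
    have := hm.ennrpow_const (1 / q.toReal - 1 / r.toReal)
    rwa [ENNReal.zero_rpow_of_pos he] at this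
  rw [ENNReal.tendsto_nhds_zero]
  intro ε hε
  obtain ⟨n, hn⟩ := (hm'.eventually (ge_mem_nhds (ENNReal.half_pos hε.ne'))).exists
  filter_upwards [(h _ (hFcomp n) (hFsub n)).eventually (ge_mem_nhds (ENNReal.half_pos hε.ne'))]
    with i hi
  have hsm := (hFc n).measurableSet
  calc _ = eLpNorm ((F n).indicator (fun x => U i x - G x) +
        (F n)ᶜ.indicator fun x => U i x - G x) q (volOn Ω) := by
        rw [indicator_self_add_compl]
    _ ≤ ε / 2 + ε / 2 := by
        refine (eLpNorm_add_le ((hD i).indicator hsm) ((hD i).indicator hsm.compl) hq).trans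
          (add_le_add ?_ (le_trans ?_ hn))
        · rwa [eLpNorm_indicator_eq_eLpNorm_restrict hsm, hres]
        · rw [eLpNorm_indicator_eq_eLpNorm_restrict hsm.compl]
          refine (eLpNorm_le_eLpNorm_mul_rpow_measure_univ hqr.le (hD i).restrict).trans ?_
          rw [Measure.restrict_apply_univ]
          gcongr
          exact (eLpNorm_mono_measure _ Measure.restrict_le_self).trans (hDK i)
    _ = ε := ENNReal.add_halves ε

/-! ### Compactness for data bounded in `L^1`, and the conclusion. -/

theorem MemW10.mono_exponent [IsFiniteMeasure (volOn Ω)] {p q : ℝ≥0∞} (hq : 1 ≤ q) (hqp : q ≤ p)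
    {u : Plane → ℝ} {U : Plane → Plane} (hu : MemW10 Ω p u U) : MemW10 Ω q u U := by
  obtain ⟨⟨hu1, hu2, -⟩, φ, h1, h2⟩ := hu
  refine .of_tendsto hq (hu1.mono_exponent hqp) (hu2.mono_exponent hqp) φ ?_ ?_
  · obtain ⟨c, hc, hle⟩ := exists_eLpNorm_le_of_exponent_le (E := ℝ) (μ := volOn Ω) hq hqp
    exact tendsto_zero_of_le (tendsto_const_mul_zero hc h1) fun n => hle _ (((φ n).memLp p).sub hu1).1
  · obtain ⟨c, hc, hle⟩ := exists_eLpNorm_le_of_exponent_le (E := Plane) (μ := volOn Ω) hq hqp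
    exact tendsto_zero_of_le (tendsto_const_mul_zero hc h2) fun n =>
      hle _ (((φ n).memLp_gradient p).sub hu2).1

theorem eLpNorm_sub_le_add {α E : Type*} [MeasurableSpace α] {μ : Measure α}
    [NormedAddCommGroup E] {f g h : α → E} (hf : AEStronglyMeasurable f μ)
    (hg : AEStronglyMeasurable g μ) (hh : AEStronglyMeasurable h μ) {p : ℝ≥0∞} (hp : 1 ≤ p) :
    eLpNorm (fun x => f x - h x) p μ ≤
      eLpNorm (fun x => f x - g x) p μ + eLpNorm (fun x => g x - h x) p μ := by
  refine (eLpNorm_congr_ae (.of_forall fun x => ?_)).trans_le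
    (eLpNorm_add_le (hf.sub hg) (hg.sub hh) hp)
  simp

theorem tendsto_eLpNorm_sub_trans {α E : Type*} [MeasurableSpace α] {μ : Measure α}
    [NormedAddCommGroup E] {f g : ℕ → α → E} {h : α → E} (hf : ∀ n, AEStronglyMeasurable (f n) μ)
    (hg : ∀ n, AEStronglyMeasurable (g n) μ) (hh : AEStronglyMeasurable h μ) {p : ℝ≥0∞}
    (hp : 1 ≤ p) (h1 : Tendsto (fun n => eLpNorm (fun x => f n x - g n x) p μ) atTop (𝓝 0))
    (h2 : Tendsto (fun n => eLpNorm (fun x => g n x - h x) p μ) atTop (𝓝 0)) :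
    Tendsto (fun n => eLpNorm (fun x => f n x - h x) p μ) atTop (𝓝 0) :=
  tendsto_zero_of_le (by simpa using h1.add h2) fun n => eLpNorm_sub_le_add (hf n) (hg n) hh hp

theorem tendsto_eLpNorm_sub_prod {α E : Type*} [MeasurableSpace α] {μ : Measure α}
    [NormedAddCommGroup E] {f : ℕ → α → E} {h : α → E} (hf : ∀ n, AEStronglyMeasurable (f n) μ)
    (hh : AEStronglyMeasurable h μ) {p : ℝ≥0∞} (hp : 1 ≤ p)
    (h1 : Tendsto (fun n => eLpNorm (fun x => f n x - h x) p μ) atTop (𝓝 0)) :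
    Tendsto (fun n : ℕ × ℕ => eLpNorm (fun x => f n.1 x - f n.2 x) p μ) atTop (𝓝 0) := by
  refine tendsto_of_tendsto_of_tendsto_of_le_of_le tendsto_const_nhds (by
    simpa using (h1.comp tendsto_fst_atTop).add (h1.comp tendsto_snd_atTop))
    (fun _ => zero_le) fun n => (eLpNorm_sub_le_add (hf n.1) hh (hf n.2) hp).trans_eq ?_
  congr 1
  exact eLpNorm_sub_comm _ _ _ _

/-- Compactness for the Dirichlet problem with data bounded in `L^1`. -/
theorem exists_subseq_tendsto_of_weakDiv (hΩ : Bornology.IsBounded (Ω : Set Plane))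
    {u g : ℕ → Plane → ℝ} {U : ℕ → Plane → Plane} (hu : ∀ i, MemW10 Ω 2 (u i) (U i))
    (h : ∀ i, WeakDiv Ω (U i) (g i)) (hg : ∀ i, Integrable (g i) (volOn Ω)) {D : ℝ≥0}
    (hD : ∀ i, eLpNorm (g i) 1 (volOn Ω) ≤ D) :
    ∃ (s : ℕ → ℕ) (w : Plane → ℝ) (G : Plane → Plane), StrictMono s ∧
      ∀ q : ℝ≥0∞, 1 ≤ q → q < 2 → MemW10 Ω q w G ∧
        Tendsto (fun i => eLpNorm (fun x => u (s i) x - w x) q (volOn Ω)) atTop (𝓝 0) ∧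
        Tendsto (fun i => eLpNorm (fun x => U (s i) x - G x) q (volOn Ω)) atTop (𝓝 0) := by
  have := isFiniteMeasure_volOn hΩ
  have hu1 := fun i => (hu i).1.1
  have hu2 := fun i => (hu i).1.2.1
  -- The exponent `4/3` has Sobolev conjugate 4 in the plane; an `L⁴` bound on the `u_i` leaves room
  -- to interpolate up to `L²`.
  have hp1 : (1 : ℝ≥0∞) ≤ (4 / 3 : ℝ≥0) := by
    rw [ENNReal.one_le_coe_iff, ← NNReal.coe_le_coe]; push_cast; norm_num
  have hp2 : ((4 / 3 : ℝ≥0) : ℝ≥0∞) < 2 := by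
    rw [← ENNReal.coe_ofNat, ENNReal.coe_lt_coe, ← NNReal.coe_lt_coe]; push_cast; norm_num
  obtain ⟨K, hK⟩ := exists_eLpNorm_gradient_le hΩ hp1 hp2 D
  replace hK := fun i => hK _ _ _ (hu i) (h i) (hg i) (hD i)
  obtain ⟨C, hC⟩ := TestFunction.sobolev hΩ (p := 4 / 3) (q := 4) (mod_cast hp1)
    (mod_cast hp2) (by push_cast; norm_num)
  have hA : ∀ i, eLpNorm (u i) 4 (volOn Ω) ≤ (C * K : ℝ≥0) := fun i => by
    rw [ENNReal.coe_mul]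
    refine (((hu i).mono_exponent hp1 hp2.le).eLpNorm_le hp1 hC).trans ?_
    gcongr
    exact hK i
  -- Each `u_i` is replaced by a test function at `W^{1,2}` distance of order `1/(i+1)`, since the
  -- Rellich lemma is for test functions; the same sequence later witnesses that the limit is in
  -- `W_0^{1,q}`.
  have hφ : ∀ i, ∃ φ : 𝓓(Ω, ℝ), eLpNorm (fun x => φ x - u i x) 2 (volOn Ω) ≤ ((i + 1 : ℕ) : ℝ≥0∞)⁻¹ ∧
      eLpNorm (fun x => gradient φ x - U i x) 2 (volOn Ω) ≤ ((i + 1 : ℕ) : ℝ≥0∞)⁻¹ := fun i => by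
    obtain ⟨-, φ, h1, h2⟩ := hu i
    have hpos : (0 : ℝ≥0∞) < ((i + 1 : ℕ) : ℝ≥0∞)⁻¹ := by simp
    obtain ⟨n, hn⟩ := ((h1.eventually (ge_mem_nhds hpos)).and
      (h2.eventually (ge_mem_nhds hpos))).exists
    exact ⟨φ n, hn⟩
  choose φ hφ1 hφ2 using hφ
  have hinv : Tendsto (fun i : ℕ => ((i + 1 : ℕ) : ℝ≥0∞)⁻¹) atTop (𝓝 0) :=
    ENNReal.tendsto_inv_nat_nhds_zero.comp (tendsto_add_atTop_nat 1)
  have hinv1 : ∀ i : ℕ, ((i + 1 : ℕ) : ℝ≥0∞)⁻¹ ≤ 1 := fun i => by simp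
  have hφm := fun i => (φ i).memLp (Ω := Ω) 2
  have hφm' := fun i => (φ i).memLp_gradient (Ω := Ω) 2
  have hlimφ : ∀ {q : ℝ≥0∞}, 1 ≤ q → q ≤ 2 →
      Tendsto (fun i => eLpNorm (fun x => φ i x - u i x) q (volOn Ω)) atTop (𝓝 0) := fun hq hq2 => by
    obtain ⟨c, hc, hle⟩ := exists_eLpNorm_le_of_exponent_le (E := ℝ) (μ := volOn Ω) hq hq2
    exact tendsto_zero_of_le (tendsto_const_mul_zero hc hinv) fun n =>
      (hle _ ((hφm n).sub (hu1 n)).1).trans (by gcongr; exact hφ1 n)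
  have hlimφ' : ∀ {q : ℝ≥0∞}, 1 ≤ q → q ≤ 2 →
      Tendsto (fun i => eLpNorm (fun x => gradient (φ i) x - U i x) q (volOn Ω)) atTop (𝓝 0) :=
    fun hq hq2 => by
    obtain ⟨c, hc, hle⟩ := exists_eLpNorm_le_of_exponent_le (E := Plane) (μ := volOn Ω) hq hq2
    exact tendsto_zero_of_le (tendsto_const_mul_zero hc hinv) fun n =>
      (hle _ ((hφm' n).sub (hu2 n)).1).trans (by gcongr; exact hφ2 n)
  have hφA : ∃ A : ℝ≥0, ∀ i, eLpNorm (φ i) 2 (volOn Ω) ≤ A := by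
    obtain ⟨c, hc, hle⟩ := exists_eLpNorm_le_of_exponent_le (E := ℝ) (μ := volOn Ω)
      one_le_two (show (2 : ℝ≥0∞) ≤ 4 by norm_num)
    lift c to ℝ≥0 using hc
    refine ⟨1 + c * (C * K), fun i => ?_⟩
    calc eLpNorm (φ i) 2 (volOn Ω) = eLpNorm ((fun x => φ i x - u i x) + u i) 2 (volOn Ω) :=
          eLpNorm_congr_ae (.of_forall fun x => by simp)
      _ ≤ 1 + c * (C * K : ℝ≥0) := (eLpNorm_add_le ((hφm i).sub (hu1 i)).1 (hu1 i).1 one_le_two).trans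
          (add_le_add ((hφ1 i).trans (hinv1 i)) ((hle _ (hu1 i).1).trans (by gcongr; exact hA i)))
      _ = _ := by push_cast; rfl
  have hφB : ∃ B : ℝ≥0, ∀ i, eLpNorm (gradient (φ i)) 1 (volOn Ω) ≤ B := by
    obtain ⟨c, hc, hle⟩ := exists_eLpNorm_le_of_exponent_le (E := Plane) (μ := volOn Ω)
      le_rfl (one_le_two (α := ℝ≥0∞))
    obtain ⟨c', hc', hle'⟩ := exists_eLpNorm_le_of_exponent_le (E := Plane) (μ := volOn Ω)
      le_rfl hp1
    lift c to ℝ≥0 using hc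
    lift c' to ℝ≥0 using hc'
    refine ⟨c * 1 + c' * K, fun i => ?_⟩
    calc eLpNorm (gradient (φ i)) 1 (volOn Ω)
        = eLpNorm ((fun x => gradient (φ i) x - U i x) + U i) 1 (volOn Ω) :=
          eLpNorm_congr_ae (.of_forall fun x => by simp)
      _ ≤ c * 1 + c' * K := (eLpNorm_add_le ((hφm' i).sub (hu2 i)).1 (hu2 i).1 le_rfl).trans
          (add_le_add ((hle _ ((hφm' i).sub (hu2 i)).1).trans (by
            gcongr; exact (hφ2 i).trans (hinv1 i))) ((hle' _ (hu2 i).1).trans (by gcongr; exact hK i)))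
      _ = _ := by push_cast; rfl
  obtain ⟨A, hφA⟩ := hφA
  obtain ⟨B, hφB⟩ := hφB
  obtain ⟨s, hs, hsC⟩ := exists_subseq_cauchy hΩ φ hφA hφB
  obtain ⟨w, hw, hlimw⟩ := exists_tendsto_eLpNorm_of_cauchy (fun n => (φ (s n)).memLp 1) hsC
  have hst := hs.tendsto_atTop
  have hw1 : Tendsto (fun i => eLpNorm (fun x => u (s i) x - w x) 1 (volOn Ω)) atTop (𝓝 0) := by
    refine tendsto_eLpNorm_sub_trans (fun n => (hu1 (s n)).1) (fun n => (hφm (s n)).1) hw.1 le_rfl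
      ?_ hlimw
    refine ((hlimφ le_rfl one_le_two).comp hst).congr fun n => ?_
    exact eLpNorm_sub_comm _ _ _ _
  have hw4 : eLpNorm w 4 (volOn Ω) ≤ (C * K : ℝ≥0) :=
    eLpNorm_le_of_tendsto_eLpNorm one_ne_zero (fun n => (hu1 (s n)).1) hw.1 hw1 fun n => hA (s n)
  have hwq : ∀ {q : ℝ≥0∞}, 1 ≤ q → q ≤ 2 →
      Tendsto (fun i => eLpNorm (fun x => u (s i) x - w x) q (volOn Ω)) atTop (𝓝 0) :=
    fun hq hq2 => tendsto_eLpNorm_of_interpolation (fun n => ((hu1 (s n)).1.sub hw.1)) hq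
      (hq2.trans_lt (by norm_num : (2 : ℝ≥0∞) < 4)) (by simp)
      (K := (C * K : ℝ≥0) + (C * K : ℝ≥0)) (by finiteness)
      (fun n => (eLpNorm_sub_le (hu1 (s n)).1 hw.1 (by norm_num)).trans
        (add_le_add (hA (s n)) hw4)) hw1
  -- The difference of two solutions solves the equation with the difference of the data, bounded by
  -- `2D` in `L^1`.
  have hUC := tendsto_eLpNorm_one_of_weakDiv (l := (atTop : Filter (ℕ × ℕ)))
    (fun n => (h (s n.1)).sub (h (s n.2)) (hu2 _) (hu2 _) (hg _) (hg _))
    (fun n => (hg (s n.1)).sub (hg (s n.2)))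
    (fun n => (hu (s n.1)).sub (by norm_num) (hu (s n.2))) (D := D + D)
    (fun n => (eLpNorm_sub_le (hg _).1 (hg _).1 le_rfl).trans
      ((add_le_add (hD _) (hD _)).trans_eq (ENNReal.coe_add _ _).symm))
    (tendsto_eLpNorm_sub_prod (fun n => (hu1 (s n)).1) hw.1 (by norm_num) (hwq one_le_two le_rfl))
  obtain ⟨G, hG, hlimG⟩ := exists_tendsto_eLpNorm_of_cauchy
    (fun n => (hu2 (s n)).mono_exponent one_le_two) hUC
  refine ⟨s, w, G, hs, fun q hq hq2 => ?_⟩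
  -- The subsequence and its limits are already fixed independently of `q`; only the auxiliary
  -- exponent `r` for interpolation depends on it.
  obtain ⟨r, hqr, hr2⟩ := exists_between hq2
  have hr1 := hq.trans hqr.le
  obtain ⟨Kr, hKr⟩ := exists_eLpNorm_gradient_le hΩ hr1 hr2 D
  replace hKr := fun i => hKr _ _ _ (hu i) (h i) (hg i) (hD i)
  have hGr : eLpNorm G r (volOn Ω) ≤ Kr := eLpNorm_le_of_tendsto_eLpNorm one_ne_zero
    (fun n => (hu2 (s n)).1) hG.1 hlimG fun n => hKr (s n)
  have hGq : Tendsto (fun i => eLpNorm (fun x => U (s i) x - G x) q (volOn Ω)) atTop (𝓝 0) :=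
    tendsto_eLpNorm_of_interpolation (fun n => ((hu2 (s n)).1.sub hG.1)) hq hqr hr2.ne_top
      (K := Kr + Kr) (by finiteness) (fun n => (eLpNorm_sub_le (hu2 (s n)).1 hG.1 hr1).trans
        (add_le_add (hKr (s n)) hGr)) hlimG
  have hwL : MemLp w q (volOn Ω) := MemLp.mono_exponent (q := 4)
    ⟨hw.1, hw4.trans_lt ENNReal.coe_lt_top⟩ (hq2.le.trans (by norm_num))
  have hGL : MemLp G q (volOn Ω) := MemLp.mono_exponent (q := r)
    ⟨hG.1, hGr.trans_lt ENNReal.coe_lt_top⟩ hqr.le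
  refine ⟨.of_tendsto hq hwL hGL (φ ∘ s) ?_ ?_, hwq hq hq2.le, hGq⟩
  · exact tendsto_eLpNorm_sub_trans (fun n => (hφm (s n)).1) (fun n => (hu1 (s n)).1) hw.1 hq
      ((hlimφ hq hq2.le).comp hst) (hwq hq hq2.le)
  · exact tendsto_eLpNorm_sub_trans (fun n => (hφm' (s n)).1) (fun n => (hu2 (s n)).1) hG.1 hq
      ((hlimφ' hq hq2.le).comp hst) hGq

theorem brezisMerle_tendsto_gradient (hΩ : Bornology.IsBounded (Ω : Set Plane)) {k : ℝ≥0∞}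
    {ε : ℝ≥0} (hk : 1 ≤ k) (hε : 0 < ε) {b C : ℝ≥0} {V u : ℕ → Plane → ℝ}
    (h : ∀ i, IsBrezisMerleSolution Ω k ε b C (V i) (u i)) {q : ℝ≥0∞} (hq : 1 ≤ q) (hq2 : q < 2)
    {w : Plane → ℝ} {G : Plane → Plane} (hG : HasWeakGradient Ω w G)
    (hS : ∀ S : Set Plane, IsCompact S → S ⊆ Ω →
      Tendsto (fun i => eLpNorm (fun x => gradient (u i) x - G x) q (volume.restrict S))
        atTop (𝓝 0)) :
    Tendsto (fun i => eLpNorm (fun x => gradient (u i) x - G x) q (volOn Ω)) atTop (𝓝 0) := by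
  obtain ⟨r, hqr, hr2⟩ := exists_between hq2
  obtain ⟨K, hK⟩ := IsBrezisMerleSolution.exists_eLpNorm_gradient_le hΩ (hq.trans hqr.le) hr2 hk hε
    b C
  exact tendsto_eLpNorm_of_forall_isCompact hΩ
    (fun i => ((h i).1.memW10 hΩ hε).1.2.1.1) hG.2.1.aestronglyMeasurable hq hqr hr2.ne_top
    (fun i => hK _ _ (h i)) hS

theorem brezisMerle_exists_subseq (hΩ : Bornology.IsBounded (Ω : Set Plane)) {k : ℝ≥0∞}
    {ε : ℝ≥0} (hk : 1 ≤ k) (hε : 0 < ε) {b C : ℝ≥0} {V u : ℕ → Plane → ℝ}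
    (h : ∀ i, IsBrezisMerleSolution Ω k ε b C (V i) (u i)) :
    ∃ (s : ℕ → ℕ) (w : Plane → ℝ) (G : Plane → Plane), StrictMono s ∧
      ∀ q : ℝ≥0∞, 1 ≤ q → q < 2 → MemW10 Ω q w G ∧
        Tendsto (fun i => eLpNorm (fun x => u (s i) x - w x) q (volOn Ω)) atTop (𝓝 0) ∧
        Tendsto (fun i => eLpNorm (fun x => gradient (u (s i)) x - G x) q (volOn Ω))
          atTop (𝓝 0) :=
  exists_subseq_tendsto_of_weakDiv hΩ (U := fun i => gradient (u i))
    (g := fun i x => V i x * Real.exp (u i x)) (fun i => (h i).1.memW10 hΩ hε)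
    (fun i => (h i).weakDiv hΩ hε) (fun i => (h i).integrable hΩ hk) fun i => (h i).eLpNorm_le

theorem mainTheorem7 (Ω : TopologicalSpace.Opens Plane)
    (hΩ : Bornology.IsBounded (Ω : Set Plane)) :
    -- uniform gradient bound
    (∀ q : ℝ≥0∞, 1 ≤ q → q < 2 → ∀ C : ℝ≥0, ∃ Cq : ℝ≥0,
      ∀ (k : ℝ≥0∞) (ε : ℝ≥0), 1 ≤ k → 0 < ε → ε ≤ 1 →
      ∀ u L : Plane → ℝ, DirichletClass Ω k ε u → HasWeakLaplacian Ω u L →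
        eLpNorm L 1 (volOn Ω) ≤ C →
        eLpNorm (gradient u) q (volOn Ω) ≤ Cq) ∧
    -- the dual problem `-Δz = div f`: solvability, sup bound and duality identity
    (∀ p : ℝ≥0∞, 2 < p → ∃ K : ℝ≥0,
      ∀ f : Plane → Plane, MemLp f p (volOn Ω) →
        (∃ (z : Plane → ℝ) (Z : Plane → Plane), IsDivSolution Ω f z Z) ∧
        ∀ (z : Plane → ℝ) (Z : Plane → Plane), IsDivSolution Ω f z Z →
          eLpNorm z ∞ (volOn Ω) ≤ K * eLpNorm f p (volOn Ω) ∧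
          ∀ (k : ℝ≥0∞) (ε : ℝ≥0), 1 ≤ k → 0 < ε → ε ≤ 1 →
          ∀ u L : Plane → ℝ, DirichletClass Ω k ε u → HasWeakLaplacian Ω u L →
            ∫ x in (Ω : Set Plane), inner ℝ (f x) (gradient u x) =
              - ∫ x in (Ω : Set Plane), inner ℝ (Z x) (gradient u x) ∧
            ∫ x in (Ω : Set Plane), inner ℝ (f x) (gradient u x) =
              ∫ x in (Ω : Set Plane), z x * L x) ∧
    -- the Brezis-Merle setting
    (∀ (k : ℝ≥0∞) (ε : ℝ≥0), 1 ≤ k → 0 < ε → ε ≤ 1 →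
      ∀ (b C : ℝ≥0) (V u : ℕ → Plane → ℝ),
      (∀ i, IsBrezisMerleSolution Ω k ε b C (V i) (u i)) →
        -- interior convergence of the gradients implies global convergence
        (∀ q : ℝ≥0∞, 1 ≤ q → q < 2 →
          ∀ (w : Plane → ℝ) (G : Plane → Plane), HasWeakGradient Ω w G →
          (∀ S : Set Plane, IsCompact S → S ⊆ Ω →
            Tendsto (fun i => eLpNorm (fun x => gradient (u i) x - G x) q (volume.restrict S))
              atTop (𝓝 0)) →
          Tendsto (fun i => eLpNorm (fun x => gradient (u i) x - G x) q (volOn Ω))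
            atTop (𝓝 0)) ∧
        -- and along a subsequence there is such a limit
        (∃ (s : ℕ → ℕ) (w : Plane → ℝ) (G : Plane → Plane), StrictMono s ∧
          ∀ q : ℝ≥0∞, 1 ≤ q → q < 2 →
            MemW10 Ω q w G ∧
            Tendsto (fun i => eLpNorm (fun x => u (s i) x - w x) q (volOn Ω)) atTop (𝓝 0) ∧
            Tendsto (fun i => eLpNorm (fun x => gradient (u (s i)) x - G x) q (volOn Ω))
              atTop (𝓝 0))) := by
  exact ⟨dirichlet_gradient_bound hΩ, dirichlet_duality hΩ, fun k ε hk hε _ b C V u h =>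
    ⟨fun q hq hq2 w G hG hS => brezisMerle_tendsto_gradient hΩ hk hε h hq hq2 hG hS,
      brezisMerle_exists_subseq hΩ hk hε h⟩⟩
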